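/- Fix $0<q<1$ and write $(a)_\infty=\prod_{i\ge 0}(1-q^ia)$, $(a)_N=\prod_{0\le i<N}(1-q^ia)$ for $N\in\mathbb{N}$, $(a)_s=(a)_\infty/(q^sa)_\infty$ for $s\in\mathbb{C}$, $\theta(a)=(a)_\infty(q/a)_\infty$ and $\Gamma_q(x)=(1-q)^{1-x}(q)_\infty/(q^x)_\infty$ (with $1/\Gamma_q=0$ at the poles of $\Gamma_q$). The Jackson integral is $$\int_a^b f(z)\,d_qz=\int_0^b f(z)\,d_qz-\int_0^a f(z)\,d_qz,\qquad \int_0^a f(z)\,d_qz=(1-q)\sum_{\nu=0}^\infty f(aq^\nu)\,aq^\nu .$$ Let $n$ be a natural number, $\tau$ a positive integer, and $t=q^\tau$. (i) Let $a_1,a_2,b_1,b_2\in\mathbb{C}$ with $a_1,a_2\ne0$ and $a_ib_jq^m\neq 1$ for all $i,j\in\{1,2\}$ and all integers $m\ge 0$. Then the following iterated Jackson integral converges absolutely (each of the $2^n$ multiple series over $\mathbb{N}^n$ into which it expands does), and $$\frac1{n!}\int_{a_1}^{a_2}\!\!\cdots\int_{a_1}^{a_2}\prod_{i=1}^n z_i^{(n-1)\tau}\frac{(qa_1^{-1}z_i)_\infty}{(b_1z_i)_\infty}\frac{(qa_2^{-1}z_i)_\infty}{(b_2z_i)_\infty}\prod_{1\le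 j<k\le n}(z_j/z_k)_\tau(z_k/z_j)_\tau\;d_qz_1\cdots d_qz_n$$ $$=(1-q)^n\prod_{j=1}^n\frac{(q)_\infty(t)_\infty(a_1a_2b_1b_2t^{n+j-2})_\infty\,(a_1a_2t^{j-1})^{(n-j)\tau}\,a_2\,\theta(a_1/a_2)}{(t^j)_\infty(a_1b_1t^{j-1})_\infty(a_1b_2t^{j-1})_\infty(a_2b_1t^{j-1})_\infty(a_2b_2t^{j-1})_\infty}.$$ (ii) (The Askey--Evans formula.) Let $x_1,x_2,\alpha,\beta\in\mathbb{C}$ with $x_1,x_2\neq0$, $x_1\ne x_2$, and suppose that none of $q^{\alpha+m}$, $q^{\beta+m}$, $q^{\alpha+m}x_2/x_1$, $q^{\beta+m}x_1/x_2$ with $m\ge0$ an integer equals $1$. Then the following iterated Jackson integral converges absolutely, in the same sense, and $$\frac1{n!}\int_{x_1}^{x_2}\!\!\cdots\int_{x_1}^{x_2}\prod_{i=1}^n\Big(\frac{qz_i}{x_1}\Big)_{\alpha-1}\Big(\frac{qz_i}{x_2}\Big)_{\beta-1}\prod_{\substack{1\le j<k\le n\\ 1-\tau\le l\le\tau-1}}(z_j-q^lz_k)\prod_{1\le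 j<k\le n}(z_j-z_k)\;d_qz_1\cdots d_qz_n$$ $$=(-1)^{\tau\binom n2}q^{\tau^2\binom n3-\binom\tau2\binom n2}\prod_{j=1}^n\frac{\Gamma_q(\alpha+(j-1)\tau)\,\Gamma_q(\beta+(j-1)\tau)\,\Gamma_q(j\tau)}{\Gamma_q(\alpha+\beta+(n+j-2)\tau)\,\Gamma_q(\tau)}\,\frac{(x_1x_2)^{1+(j-1)\tau}}{x_1-x_2}\Big(\frac{x_2}{x_1}\Big)_{\alpha+(j-1)\tau}\Big(\frac{x_1}{x_2}\Big)_{\beta+(j-1)\tau}.$$ -/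

import Mathlib

open scoped BigOperators

noncomputable section

namespace QSelberg

/-- The infinite `q`-shifted factorial `(a)_∞ = ∏_{i ≥ 0} (1 - q^i a)`. -/
def qPochInf (q : ℝ) (a : ℂ) : ℂ := ∏' i : ℕ, (1 - (q : ℂ) ^ i * a)

/-- The finite `q`-shifted factorial `(a)_N = ∏_{0 ≤ i < N} (1 - q^i a)` for a natural number `N`.
This is the quotient `(a)_∞ / (q^N a)_∞` with its removable singularities removed. -/
def qPoch (q : ℝ) (a : ℂ) (N : ℕ) : ℂ := ∏ i ∈ Finset.range N, (1 - (q : ℂ) ^ i * a)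

/-- The `q`-shifted factorial `(a)_s = (a)_∞ / (q^s a)_∞` with a complex index `s`. -/
def qPochC (q : ℝ) (a s : ℂ) : ℂ := qPochInf q a / qPochInf q ((q : ℂ) ^ s * a)

/-- The theta function `θ(a) = (a)_∞ (q/a)_∞`. -/
def theta (q : ℝ) (a : ℂ) : ℂ := qPochInf q a * qPochInf q ((q : ℂ) / a)

/-- The `q`-gamma function `Γ_q(x) = (1 - q)^(1 - x) (q)_∞ / (q^x)_∞`. At a pole of `Γ_q` its value
here is `0`, so that there `1 / Γ_q` has its correct value `0`. -/
def qGamma (q : ℝ) (x : ℂ) : ℂ :=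
  (1 - (q : ℂ)) ^ (1 - x) * qPochInf q (q : ℂ) / qPochInf q ((q : ℂ) ^ x)

/-- The Jackson integral `∫_0^a f(z) d_q z = (1 - q) ∑_{ν ≥ 0} f(a q^ν) a q^ν`. -/
def jacksonFromZero (q : ℝ) (a : ℂ) (f : ℂ → ℂ) : ℂ :=
  (1 - (q : ℂ)) * ∑' ν : ℕ, f (a * (q : ℂ) ^ ν) * (a * (q : ℂ) ^ ν)

/-- The Jackson integral `∫_a^b f(z) d_q z = ∫_0^b f(z) d_q z - ∫_0^a f(z) d_q z`. -/
def jackson (q : ℝ) (a b : ℂ) (f : ℂ → ℂ) : ℂ :=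
  jacksonFromZero q b f - jacksonFromZero q a f

/-- The `n`-fold iterated Jackson integral
`∫_a^b ⋯ ∫_a^b f(z_1, …, z_n) d_q z_1 ⋯ d_q z_n`. -/
def iteratedJackson (q : ℝ) (a b : ℂ) : (n : ℕ) → ((Fin n → ℂ) → ℂ) → ℂ
  | 0, f => f Fin.elim0
  | n + 1, f => jackson q a b fun z =>
      iteratedJackson q a b n fun w => f (Fin.cons z w : Fin (n + 1) → ℂ)

/-- Absolute convergence of the iterated Jackson integral over `[a, b]^n`: each of the `2^n` multiple
series over `ℕ^n` into which it expands (one for each choice of the end point `a` or `b` in every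
variable) converges absolutely. -/
def JacksonConverges (q : ℝ) (a b : ℂ) (n : ℕ) (f : (Fin n → ℂ) → ℂ) : Prop :=
  ∀ c : Fin n → ℂ, (∀ i, c i = a ∨ c i = b) →
    Summable fun ν : Fin n → ℕ =>
      ‖f (fun i => c i * (q : ℂ) ^ ν i) * ∏ i, (c i * (q : ℂ) ^ ν i)‖

/-- The integrand
`∏_i z_i^((n-1)τ) (q z_i/a₁)_∞ (q z_i/a₂)_∞ / ((b₁ z_i)_∞ (b₂ z_i)_∞) ∏_{j<k} (z_j/z_k)_τ (z_k/z_j)_τ`. -/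
def integrand (q : ℝ) (n τ : ℕ) (a₁ a₂ b₁ b₂ : ℂ) (z : Fin n → ℂ) : ℂ :=
  (∏ i, z i ^ ((n - 1) * τ) *
    (qPochInf q ((q : ℂ) * a₁⁻¹ * z i) / qPochInf q (b₁ * z i)) *
    (qPochInf q ((q : ℂ) * a₂⁻¹ * z i) / qPochInf q (b₂ * z i))) *
  ∏ j, ∏ k ∈ Finset.Ioi j, qPoch q (z j / z k) τ * qPoch q (z k / z j) τ

/-- The integrand
`∏_i (q z_i/x₁)_{α-1} (q z_i/x₂)_{β-1} ∏_{j<k} ∏_{1-τ ≤ l ≤ τ-1} (z_j - q^l z_k) ∏_{j<k} (z_j - z_k)`. -/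
def askeyEvansIntegrand (q : ℝ) (n τ : ℕ) (x₁ x₂ α β : ℂ) (z : Fin n → ℂ) : ℂ :=
  (∏ i, qPochC q ((q : ℂ) * z i / x₁) (α - 1) * qPochC q ((q : ℂ) * z i / x₂) (β - 1)) *
  (∏ j, ∏ k ∈ Finset.Ioi j, ∏ l ∈ Finset.Icc (1 - (τ : ℤ)) ((τ : ℤ) - 1),
    (z j - (q : ℂ) ^ l * z k)) *
  ∏ j, ∏ k ∈ Finset.Ioi j, (z j - z k)

/-- `(a)_∞ = (a)_N (q^N a)_∞`: the finite product is the quotient `(a)_∞ / (q^N a)_∞`. -/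
theorem qPochInf_eq_qPoch_mul (q : ℝ) (hq0 : 0 < q) (hq1 : q < 1) (a : ℂ) (N : ℕ) :
    qPochInf q a = qPoch q a N * qPochInf q ((q : ℂ) ^ N * a) := by
  have hm : ∀ b : ℂ, Multipliable fun i : ℕ => (1 - (q : ℂ) ^ i * b) := by
    intro b
    have : Summable fun i : ℕ => ‖-((q : ℂ) ^ i * b)‖ := by
      simp only [norm_neg, norm_mul, norm_pow, Complex.norm_real, Real.norm_eq_abs, abs_of_pos hq0]
      exact (summable_geometric_of_lt_one hq0.le hq1).mul_right _
    simpa [sub_eq_add_neg] using multipliable_one_add_of_summable this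
  have h2 := hm ((q : ℂ) ^ N * a)
  unfold qPochInf qPoch
  have h3 : Multipliable fun i : ℕ => (1 - (q : ℂ) ^ (i + N) * a) := by
    simpa [pow_add, mul_assoc] using h2
  have := h3.prod_mul_tprod_nat_mul' (f := fun i : ℕ => (1 - (q : ℂ) ^ i * a)) (k := N)
  rw [← this]
  simp [pow_add, mul_assoc]

end QSelberg

end

/-!
The two formulas are one: for `b₁ = q^α / x₁` and `b₂ = q^β / x₂` the Askey--Evans integrand is a
constant multiple of the integrand of (i) (`askeyEvansIntegrand_eq`), and the right-hand sides
correspond (`prod_askeyEvansFactor`). So (i) is what has to be proved.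

Since `t = q^τ`, the interaction of the variables is a polynomial `P`, homogeneous and symmetric:
`P(z) = ∏_{j ≠ k} ∏_{s < τ} (z_j - q^s z_k)` (`selbergPoly`). The integral is therefore the value
on `P` of the `n`-th power of a one-dimensional functional `L` (`iteratedJackson_integrand`). A
telescoping sum gives `(Y)_m L[(b₁ z)_m] = (a₁b₁)_m (a₂b₁)_m L[1]` with `Y = a₁a₂b₁b₂`
(`qPoch_mul_jacksonMoment`), and `L[1]` follows by letting `b₁, b₂ → 0` and comparing with
`b_i = q / a_i`, where the weight is constant (`jacksonMoment_base`).

What remains is an algebraic identity for `F(x, y, Y) = (L / L[1])^{⊗ n}[b₁^{deg P} P]`, where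
`x = a₁b₁`, `y = a₂b₁` (`selbergSum`).

* Expand `P` in products of `(b₁ z_i)_{m_i}`. The coefficient of index `m` is a combination of the
  values of `P` at the points `(q^{-ν_i})` with `ν ≤ m`, and `P` vanishes there unless the `ν_i`
  are pairwise at distance at least `τ`. Hence, after sorting, `m_j ≥ jτ`, and
  `∏_{j < n} (x)_{jτ}` divides `F` as a polynomial in `x` (`lowerFactor_dvd`).
* The weight is symmetric in `b₁, b₂`, so the same expansion in `b₂` shows that `F` is divisible
  by `x^h ∏_{j < n} (Y/x)_{jτ}`, where `2h = deg P`. The two factors are coprime and their degrees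
  add up to the degree bound `2h` for `F`, so `F` is known up to a factor independent of `x`
  (`exists_selbergSumPoly_eq`), and, `F` being symmetric in `x, y`, up to one depending only on `Y`.
* That factor is found from the top coefficient in `x` at `y = Y q^((n-1)τ)`. There the functional
  is supported on `1, q, …, q^((n-1)τ)`, where only the rearrangements of `1, t, …, t^(n-1)` are
  separated (`selbergTop_special`), so the `n`-fold sum has `n!` equal terms.

The argument needs `b₁, b₂ ≠ 0` and `Y q^m ≠ 1`; the excluded parameters are reached by continuity
(`momentFunctional_eq`).
-/

noncomputable section

namespace QSelberg

open Filter Topology Polynomial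

/-! ### The `q`-shifted factorials -/

lemma ofReal_q_ne_zero {q : ℝ} (hq0 : 0 < q) : (q : ℂ) ≠ 0 :=
  Complex.ofReal_ne_zero.mpr hq0.ne'

lemma norm_ofReal_q_pow {q : ℝ} (hq0 : 0 < q) (i : ℕ) : ‖(q : ℂ) ^ i‖ = q ^ i := by
  rw [norm_pow, Complex.norm_real, Real.norm_eq_abs, abs_of_pos hq0]

lemma q_pow_ne_one {q : ℝ} (hq0 : 0 < q) (hq1 : q < 1) {i : ℕ} (hi : i ≠ 0) :
    (q : ℂ) ^ i ≠ 1 := by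
  intro h
  have := congrArg norm h
  rw [norm_ofReal_q_pow hq0, norm_one] at this
  exact (pow_lt_one₀ hq0.le hq1 hi).ne this

lemma q_pow_injective {q : ℝ} (hq0 : 0 < q) (hq1 : q < 1) {i j : ℕ}
    (h : (q : ℂ) ^ i = (q : ℂ) ^ j) : i = j := by
  have := congrArg norm h
  rw [norm_ofReal_q_pow hq0, norm_ofReal_q_pow hq0] at this
  exact pow_right_injective₀ hq0 hq1.ne this

lemma summable_norm_q_pow_mul {q : ℝ} (hq0 : 0 < q) (hq1 : q < 1) (a : ℂ) :
    Summable fun i : ℕ => ‖-((q : ℂ) ^ i * a)‖ := by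
  simp only [norm_neg, norm_mul, norm_ofReal_q_pow hq0]
  exact (summable_geometric_of_lt_one hq0.le hq1).mul_right _

lemma qPochInf_zero (q : ℝ) : qPochInf q 0 = 1 := by simp [qPochInf]

lemma continuous_qPochInf {q : ℝ} (hq0 : 0 < q) (hq1 : q < 1) : Continuous (qPochInf q) := by
  rw [continuous_iff_continuousAt]
  intro a
  have := tendsto_tprod_one_add_of_dominated_convergence (𝓕 := 𝓝 a)
    (f := fun (b : ℂ) (i : ℕ) => -((q : ℂ) ^ i * b)) (g := fun i => -((q : ℂ) ^ i * a))
    (bound := fun i => q ^ i * (‖a‖ + 1))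
    ((summable_geometric_of_lt_one hq0.le hq1).mul_right _)
    (fun k => Continuous.tendsto (by fun_prop) a) ?_
  · simp only [← sub_eq_add_neg] at this
    exact this
  · have h1 : ∀ᶠ b in 𝓝 a, ‖b‖ < ‖a‖ + 1 :=
      (continuous_norm.tendsto a).eventually (gt_mem_nhds (by linarith))
    filter_upwards [h1] with b hb k
    rw [norm_neg, norm_mul, norm_ofReal_q_pow hq0]
    gcongr

lemma qPochInf_ne_zero {q : ℝ} (hq0 : 0 < q) (hq1 : q < 1) {a : ℂ}
    (ha : ∀ m : ℕ, a * (q : ℂ) ^ m ≠ 1) : qPochInf q a ≠ 0 := by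
  have := tprod_one_add_ne_zero_of_summable (f := fun i : ℕ => -((q : ℂ) ^ i * a))
    (fun i h => ha i (by linear_combination -h)) (summable_norm_q_pow_mul hq0 hq1 a)
  simp only [← sub_eq_add_neg] at this
  exact this

lemma qPoch_succ (q : ℝ) (a : ℂ) (N : ℕ) :
    qPoch q a (N + 1) = qPoch q a N * (1 - (q : ℂ) ^ N * a) := by
  simp [qPoch, Finset.prod_range_succ]

lemma qPoch_succ' (q : ℝ) (a : ℂ) (N : ℕ) :
    qPoch q a (N + 1) = (1 - a) * qPoch q ((q : ℂ) * a) N := by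
  simp [qPoch, Finset.prod_range_succ', pow_succ, mul_assoc, mul_comm]

lemma qPoch_add (q : ℝ) (a : ℂ) (M N : ℕ) :
    qPoch q a (M + N) = qPoch q a M * qPoch q ((q : ℂ) ^ M * a) N := by
  simp only [qPoch, Finset.prod_range_add]
  congr 1
  exact Finset.prod_congr rfl fun i _ => by ring

lemma qPoch_ne_zero {q : ℝ} {a : ℂ} {N : ℕ}
    (ha : ∀ m < N, a * (q : ℂ) ^ m ≠ 1) : qPoch q a N ≠ 0 := by
  refine Finset.prod_ne_zero_iff.mpr fun i hi h => ha i (Finset.mem_range.mp hi) ?_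
  linear_combination -h

lemma qPoch_eq_zero {q : ℝ} {a : ℂ} {N m : ℕ} (hm : m < N)
    (ha : (q : ℂ) ^ m * a = 1) : qPoch q a N = 0 :=
  Finset.prod_eq_zero (Finset.mem_range.mpr hm) (by rw [ha, sub_self])

lemma qPochInf_eq_zero {q : ℝ} (hq0 : 0 < q) (hq1 : q < 1) {a : ℂ} {m : ℕ}
    (ha : (q : ℂ) ^ m * a = 1) : qPochInf q a = 0 := by
  rw [qPochInf_eq_qPoch_mul q hq0 hq1 a (m + 1), qPoch_eq_zero (Nat.lt_succ_self m) ha, zero_mul]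

lemma qPochInf_succ {q : ℝ} (hq0 : 0 < q) (hq1 : q < 1) (a : ℂ) :
    qPochInf q a = (1 - a) * qPochInf q ((q : ℂ) * a) := by
  simpa [qPoch] using qPochInf_eq_qPoch_mul q hq0 hq1 a 1

lemma qPoch_q_ne_zero {q : ℝ} (hq0 : 0 < q) (hq1 : q < 1) (N : ℕ) : qPoch q (q : ℂ) N ≠ 0 :=
  qPoch_ne_zero fun m _ => by rw [← pow_succ']; exact q_pow_ne_one hq0 hq1 m.succ_ne_zero

lemma qPochInf_q_ne_zero {q : ℝ} (hq0 : 0 < q) (hq1 : q < 1) : qPochInf q (q : ℂ) ≠ 0 :=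
  qPochInf_ne_zero hq0 hq1 fun m => by
    rw [← pow_succ']; exact q_pow_ne_one hq0 hq1 m.succ_ne_zero

lemma tendsto_q_pow {q : ℝ} (hq0 : 0 < q) (hq1 : q < 1) :
    Tendsto (fun N : ℕ => (q : ℂ) ^ N) atTop (𝓝 0) :=
  tendsto_pow_atTop_nhds_zero_of_norm_lt_one (by
    rwa [Complex.norm_real, Real.norm_eq_abs, abs_of_pos hq0])

lemma tendsto_qPoch {q : ℝ} (hq0 : 0 < q) (hq1 : q < 1) (a : ℂ) :
    Tendsto (fun N => qPoch q a N) atTop (𝓝 (qPochInf q a)) := by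
  have : Multipliable fun i : ℕ => (1 - (q : ℂ) ^ i * a) := by
    simpa [sub_eq_add_neg] using
      multipliable_one_add_of_summable (summable_norm_q_pow_mul hq0 hq1 a)
  exact this.hasProd.tendsto_prod_nat

/-! ### Newton interpolation at the nodes `1, q⁻¹, q⁻², …` -/

/-- The `q`-shifted factorial `(X)_m`, as a polynomial in its argument. -/
def qPochPoly (q : ℝ) (m : ℕ) : ℂ[X] := ∏ i ∈ Finset.range m, (1 - C ((q : ℂ) ^ i) * X)

lemma eval_qPochPoly (q : ℝ) (m : ℕ) (a : ℂ) : (qPochPoly q m).eval a = qPoch q a m := by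
  simp [qPochPoly, qPoch, eval_prod]

lemma qPochPoly_succ (q : ℝ) (m : ℕ) :
    qPochPoly q (m + 1) = qPochPoly q m * (1 - C ((q : ℂ) ^ m) * X) := by
  simp [qPochPoly, Finset.prod_range_succ]

lemma natDegree_qPochPoly_le (q : ℝ) (m : ℕ) : (qPochPoly q m).natDegree ≤ m := by
  refine (natDegree_prod_le _ _).trans ?_
  refine (Finset.sum_le_card_nsmul _ _ 1 fun i _ => ?_).trans (by simp)
  compute_degree

/-- The leading coefficient of `(X)_m`. -/
def qPochLead (q : ℝ) (m : ℕ) : ℂ := ∏ i ∈ Finset.range m, -(q : ℂ) ^ i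

lemma coeff_qPochPoly_self (q : ℝ) (m : ℕ) : (qPochPoly q m).coeff m = qPochLead q m := by
  induction m with
  | zero => simp [qPochPoly, qPochLead]
  | succ m ih =>
    have h1 : (1 - C ((q : ℂ) ^ m) * X).natDegree ≤ 1 := by compute_degree
    have h2 : (1 - C ((q : ℂ) ^ m) * X).coeff 1 = -(q : ℂ) ^ m := by
      simp [coeff_one, -map_pow]
    rw [qPochPoly_succ, coeff_mul_add_eq_of_natDegree_le (natDegree_qPochPoly_le q m) h1, ih, h2,
      qPochLead, qPochLead, Finset.prod_range_succ]

lemma qPochLead_ne_zero {q : ℝ} (hq0 : 0 < q) (m : ℕ) : qPochLead q m ≠ 0 :=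
  Finset.prod_ne_zero_iff.mpr fun i _ => neg_ne_zero.mpr (pow_ne_zero i (ofReal_q_ne_zero hq0))

lemma qPochPoly_ne_zero {q : ℝ} (hq0 : 0 < q) (m : ℕ) : qPochPoly q m ≠ 0 := by
  intro h
  have := coeff_qPochPoly_self q m
  rw [h, coeff_zero] at this
  exact qPochLead_ne_zero hq0 m this.symm

/-- The coefficients of the `q`-binomial theorem, characterised by the functional equation
`(1 - X) (qX)_k = (1 - q^k X) (X)_k`. -/
lemma coeff_qPochPoly_mul (q : ℝ) (k ν : ℕ) :
    (qPochPoly q k).coeff ν * qPoch q (q : ℂ) ν =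
      ∏ i ∈ Finset.range ν, ((q : ℂ) ^ k - (q : ℂ) ^ i) := by
  have hfe : (qPochPoly q k).comp (C (q : ℂ) * X) * (1 - X) =
      qPochPoly q k * (1 - C ((q : ℂ) ^ k) * X) := by
    rw [← qPochPoly_succ, qPochPoly, qPochPoly, Finset.prod_range_succ', prod_comp]
    congr 1
    · refine Finset.prod_congr rfl fun i _ => ?_
      simp only [sub_comp, one_comp, mul_comp, C_comp, X_comp, pow_succ, C_mul, mul_assoc]
    · simp
  induction ν with
  | zero =>
    have h0 : (qPochPoly q k).coeff 0 = 1 := by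
      rw [coeff_zero_eq_eval_zero, eval_qPochPoly]; simp [qPoch]
    simp [h0, qPoch]
  | succ ν ih =>
    have h := congrArg (fun p => p.coeff (ν + 1)) hfe
    simp only [mul_sub, mul_one, coeff_sub, coeff_mul_X, ← mul_assoc] at h
    simp only [comp_C_mul_X_coeff, coeff_mul_C] at h
    rw [qPoch_succ, Finset.prod_range_succ, ← ih]
    linear_combination (-qPoch q (q : ℂ) ν) * h

/-- The coefficient of `(X)_m` in the expansion of `X ^ d` in the basis of `q`-shifted
factorials. -/
def newtonCoeff (q : ℝ) (d m : ℕ) : ℂ :=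
  (q : ℂ) ^ m / qPoch q (q : ℂ) m * qPoch q (((q : ℂ) ^ d)⁻¹) m

lemma newtonCoeff_eq_zero {q : ℝ} (hq0 : 0 < q) {d m : ℕ} (h : d < m) :
    newtonCoeff q d m = 0 := by
  rw [newtonCoeff, qPoch_eq_zero h (mul_inv_cancel₀ (pow_ne_zero d (ofReal_q_ne_zero hq0))),
    mul_zero]

/-- The terminating `q`-Chu--Vandermonde sum, as an expansion of `X ^ d`. -/
lemma pow_eq_sum_newtonCoeff {q : ℝ} (hq0 : 0 < q) (hq1 : q < 1) (d N : ℕ) (hd : d < N) :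
    (X : ℂ[X]) ^ d = ∑ m ∈ Finset.range N, C (newtonCoeff q d m) * qPochPoly q m := by
  have hq := ofReal_q_ne_zero hq0
  -- both sides are compared by multiplying the expansion of `X ^ d` by `X`
  induction d generalizing N with
  | zero =>
    obtain ⟨N, rfl⟩ := Nat.exists_eq_succ_of_ne_zero hd.ne'
    rw [Finset.sum_range_succ', Finset.sum_eq_zero]
    · simp [newtonCoeff, qPochPoly, qPoch]
    · intro m _
      rw [newtonCoeff_eq_zero hq0 m.succ_pos, C_0, zero_mul]
  | succ d ih =>
    obtain ⟨N, rfl⟩ := Nat.exists_eq_succ_of_ne_zero (Nat.ne_of_gt (Nat.zero_lt_of_lt hd))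
    have hX : ∀ m, X * qPochPoly q m =
        C (((q : ℂ) ^ m)⁻¹) * (qPochPoly q m - qPochPoly q (m + 1)) := by
      intro m
      have hc : C (((q : ℂ) ^ m)⁻¹) * C ((q : ℂ) ^ m) = 1 := by
        rw [← C_mul, inv_mul_cancel₀ (pow_ne_zero m hq), C_1]
      rw [qPochPoly_succ]
      linear_combination (-X * qPochPoly q m) * hc
    have key : ∀ m, newtonCoeff q (d + 1) (m + 1) =
        newtonCoeff q d (m + 1) * ((q : ℂ) ^ (m + 1))⁻¹ -
          newtonCoeff q d m * ((q : ℂ) ^ m)⁻¹ := by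
      intro m
      have h1 := qPoch_q_ne_zero hq0 hq1 m
      have h2 := qPoch_q_ne_zero hq0 hq1 (m + 1)
      have e1 := qPoch_succ q (q : ℂ) m
      have e2 := qPoch_succ q (((q : ℂ) ^ d)⁻¹) m
      have e3 := qPoch_succ' q (((q : ℂ) ^ (d + 1))⁻¹) m
      have e4 : (q : ℂ) * ((q : ℂ) ^ (d + 1))⁻¹ = ((q : ℂ) ^ d)⁻¹ := by
        field_simp
        ring
      rw [e4] at e3
      rw [e1] at h2
      have h3 : 1 - (q : ℂ) ^ m * q ≠ 0 := right_ne_zero_of_mul h2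
      simp only [newtonCoeff, e1, e2, e3]
      field_simp
      ring
    have k0 : newtonCoeff q (d + 1) 0 = newtonCoeff q d 0 * ((q : ℂ) ^ 0)⁻¹ := by
      simp [newtonCoeff, qPoch]
    rw [pow_succ', ih N (Nat.lt_of_succ_lt_succ hd), Finset.mul_sum, Finset.sum_range_succ']
    simp only [key, k0, C_sub, sub_mul, Finset.sum_sub_distrib]
    have hN : newtonCoeff q d N = 0 := newtonCoeff_eq_zero hq0 (Nat.lt_of_succ_lt_succ hd)
    have h4 := Finset.sum_range_succ' (fun m =>
      C (newtonCoeff q d m * ((q : ℂ) ^ m)⁻¹) * qPochPoly q m) N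
    rw [Finset.sum_range_succ, hN, zero_mul, C_0, zero_mul, add_zero] at h4
    rw [sub_add_eq_add_sub, ← h4, ← Finset.sum_sub_distrib]
    refine Finset.sum_congr rfl fun m _ => ?_
    rw [mul_left_comm, hX m, C_mul]
    ring

/-- The moments `Λ(u ^ d)` of the linear functional `Λ` with `Λ((u)_m) = e m`. -/
def newtonMoment (q : ℝ) {A : Type*} [CommRing A] [Algebra ℂ A] (e : ℕ → A) (d : ℕ) : A :=
  ∑ m ∈ Finset.range (d + 1), newtonCoeff q d m • e m

lemma newtonMoment_eq_sum {q : ℝ} (hq0 : 0 < q) {A : Type*} [CommRing A] [Algebra ℂ A]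
    (e : ℕ → A) {d N : ℕ} (hd : d < N) :
    newtonMoment q e d = ∑ m ∈ Finset.range N, newtonCoeff q d m • e m := by
  refine Finset.sum_subset (Finset.range_subset_range.mpr hd) fun m _ hm => ?_
  rw [newtonCoeff_eq_zero hq0 (by simpa using hm), zero_smul]

/-! ### The one-dimensional Jackson integral -/

/-- The parameters of part (i): `a₁, a₂ ≠ 0`, and no `a_i b_j q^m` with `m ≥ 0` equals `1`. -/
structure Admissible (q : ℝ) (a₁ a₂ b₁ b₂ : ℂ) : Prop where
  a₁_ne : a₁ ≠ 0
  a₂_ne : a₂ ≠ 0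
  h₁₁ : ∀ m : ℕ, a₁ * b₁ * (q : ℂ) ^ m ≠ 1
  h₁₂ : ∀ m : ℕ, a₁ * b₂ * (q : ℂ) ^ m ≠ 1
  h₂₁ : ∀ m : ℕ, a₂ * b₁ * (q : ℂ) ^ m ≠ 1
  h₂₂ : ∀ m : ℕ, a₂ * b₂ * (q : ℂ) ^ m ≠ 1

lemma Admissible.swap {q : ℝ} {a₁ a₂ b₁ b₂ : ℂ} (h : Admissible q a₁ a₂ b₁ b₂) :
    Admissible q a₁ a₂ b₂ b₁ :=
  ⟨h.a₁_ne, h.a₂_ne, h.h₁₂, h.h₁₁, h.h₂₂, h.h₂₁⟩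

lemma Admissible.q_mul {q : ℝ} {a₁ a₂ b₁ b₂ : ℂ} (h : Admissible q a₁ a₂ b₁ b₂) (N : ℕ) :
    Admissible q a₁ a₂ ((q : ℂ) ^ N * b₁) b₂ := by
  refine ⟨h.a₁_ne, h.a₂_ne, fun m e => h.h₁₁ (N + m) ?_, h.h₁₂, fun m e => h.h₂₁ (N + m) ?_,
    h.h₂₂⟩ <;> rw [pow_add, ← e] <;> ring

lemma Admissible.zero_left {q : ℝ} {a₁ a₂ b₁ b₂ : ℂ} (h : Admissible q a₁ a₂ b₁ b₂) :
    Admissible q a₁ a₂ 0 b₂ :=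
  ⟨h.a₁_ne, h.a₂_ne, by simp, h.h₁₂, by simp, h.h₂₂⟩

/-- The one-dimensional weight `(q z / a₁)_∞ (q z / a₂)_∞ / ((b₁ z)_∞ (b₂ z)_∞)`. -/
def weight (q : ℝ) (a₁ a₂ b₁ b₂ z : ℂ) : ℂ :=
  qPochInf q ((q : ℂ) * a₁⁻¹ * z) / qPochInf q (b₁ * z) *
    (qPochInf q ((q : ℂ) * a₂⁻¹ * z) / qPochInf q (b₂ * z))

lemma weight_swap (q : ℝ) (a₁ a₂ b₁ b₂ z : ℂ) :
    weight q a₁ a₂ b₁ b₂ z = weight q a₁ a₂ b₂ b₁ z := by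
  unfold weight; ring

/-- The moment `∫_{a₁}^{a₂} w(z) z ^ d d_q z` of the weight. -/
def jacksonMoment (q : ℝ) (a₁ a₂ b₁ b₂ : ℂ) (d : ℕ) : ℂ :=
  jackson q a₁ a₂ fun z => weight q a₁ a₂ b₁ b₂ z * z ^ d

lemma jacksonMoment_swap (q : ℝ) (a₁ a₂ b₁ b₂ : ℂ) (d : ℕ) :
    jacksonMoment q a₁ a₂ b₁ b₂ d = jacksonMoment q a₁ a₂ b₂ b₁ d := by
  simp only [jacksonMoment, weight_swap q a₁ a₂ b₁ b₂]

lemma qPochInf_mul_pow_ne_zero {q : ℝ} (hq0 : 0 < q) (hq1 : q < 1) {a b : ℂ}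
    (h : ∀ m : ℕ, a * b * (q : ℂ) ^ m ≠ 1) (ν : ℕ) : qPochInf q (b * (a * (q : ℂ) ^ ν)) ≠ 0 :=
  qPochInf_ne_zero hq0 hq1 fun m e => h (ν + m) (by rw [pow_add, ← e]; ring)

lemma continuousAt_weight {q : ℝ} (hq0 : 0 < q) (hq1 : q < 1) (a₁ a₂ : ℂ) (p : (ℂ × ℂ) × ℂ)
    (h₁ : qPochInf q (p.1.1 * p.2) ≠ 0) (h₂ : qPochInf q (p.1.2 * p.2) ≠ 0) :
    ContinuousAt (fun p : (ℂ × ℂ) × ℂ => weight q a₁ a₂ p.1.1 p.1.2 p.2) p := by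
  have hc := continuous_qPochInf hq0 hq1
  unfold weight
  refine ContinuousAt.mul (ContinuousAt.div ?_ ?_ h₁) (ContinuousAt.div ?_ ?_ h₂)
  · exact (hc.comp (by fun_prop)).continuousAt
  · exact (hc.comp (f := fun p : (ℂ × ℂ) × ℂ => p.1.1 * p.2) (by fun_prop)).continuousAt
  · exact (hc.comp (by fun_prop)).continuousAt
  · exact (hc.comp (f := fun p : (ℂ × ℂ) × ℂ => p.1.2 * p.2) (by fun_prop)).continuousAt

/-- The weight is bounded along `a q^ν`, uniformly for `(b₁, b₂)` near a given point. The closure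
of `{a q^ν}` is compact, and the weight is continuous on it. -/
lemma exists_weight_bound {q : ℝ} (hq0 : 0 < q) (hq1 : q < 1) (a₁ a₂ : ℂ) {a b₁ b₂ : ℂ}
    (h₁ : ∀ m : ℕ, a * b₁ * (q : ℂ) ^ m ≠ 1) (h₂ : ∀ m : ℕ, a * b₂ * (q : ℂ) ^ m ≠ 1) :
    ∃ K, ∀ᶠ p : ℂ × ℂ in 𝓝 (b₁, b₂), ∀ ν : ℕ, ‖weight q a₁ a₂ p.1 p.2 (a * (q : ℂ) ^ ν)‖ ≤ K := by
  have hlim : Tendsto (fun ν : ℕ => a * (q : ℂ) ^ ν) atTop (𝓝 0) := by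
    simpa using (tendsto_q_pow hq0 hq1).const_mul a
  have hcpt := hlim.isCompact_insert_range
  set T : Set ℂ := insert 0 (Set.range fun ν : ℕ => a * (q : ℂ) ^ ν)
  have hT : ∀ t ∈ T, ContinuousAt (fun p : (ℂ × ℂ) × ℂ => weight q a₁ a₂ p.1.1 p.1.2 p.2)
      ((b₁, b₂), t) := by
    rintro t (rfl | ⟨ν, rfl⟩)
    · exact continuousAt_weight hq0 hq1 _ _ _ (by simp [qPochInf_zero]) (by simp [qPochInf_zero])
    · exact continuousAt_weight hq0 hq1 _ _ _ (qPochInf_mul_pow_ne_zero hq0 hq1 h₁ ν)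
        (qPochInf_mul_pow_ne_zero hq0 hq1 h₂ ν)
  have hcont : ContinuousOn (fun t => weight q a₁ a₂ b₁ b₂ t) T := fun t ht =>
    (ContinuousAt.comp (f := fun t : ℂ => ((b₁, b₂), t)) (hT t ht)
      (by fun_prop)).continuousWithinAt
  obtain ⟨K, hK⟩ := hcpt.exists_bound_of_continuousOn hcont
  refine ⟨K + 1, ?_⟩
  have := hcpt.eventually_forall_of_forall_eventually (x₀ := (b₁, b₂))
    (P := fun p t => ‖weight q a₁ a₂ p.1 p.2 t‖ < K + 1) fun t ht =>
      (hT t ht).norm.eventually (gt_mem_nhds (by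
        have := hK t ht
        show ‖weight q a₁ a₂ b₁ b₂ t‖ < K + 1
        linarith))
  filter_upwards [this] with p hp ν
  exact (hp _ (Set.mem_insert_of_mem _ ⟨ν, rfl⟩)).le

lemma norm_weight_term_le {q : ℝ} (hq0 : 0 < q) (hq1 : q < 1) {a₁ a₂ a b₁ b₂ : ℂ} {K : ℝ}
    (hK : ∀ ν : ℕ, ‖weight q a₁ a₂ b₁ b₂ (a * (q : ℂ) ^ ν)‖ ≤ K) (d ν : ℕ) :
    ‖weight q a₁ a₂ b₁ b₂ (a * (q : ℂ) ^ ν) * (a * (q : ℂ) ^ ν) ^ d * (a * (q : ℂ) ^ ν)‖ ≤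
      K * ‖a‖ ^ (d + 1) * q ^ ν := by
  have h1 : (q ^ ν) ^ (d + 1) ≤ q ^ ν :=
    pow_le_of_le_one (by positivity) (pow_le_one₀ hq0.le hq1.le) d.succ_ne_zero
  rw [mul_assoc, ← pow_succ, norm_mul, norm_pow, norm_mul, norm_ofReal_q_pow hq0, mul_pow,
    mul_assoc K]
  exact mul_le_mul (hK ν) (mul_le_mul_of_nonneg_left h1 (by positivity)) (by positivity)
    ((norm_nonneg _).trans (hK 0))

lemma summable_weight_term {q : ℝ} (hq0 : 0 < q) (hq1 : q < 1) (a₁ a₂ : ℂ) {a b₁ b₂ : ℂ}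
    (h₁ : ∀ m : ℕ, a * b₁ * (q : ℂ) ^ m ≠ 1) (h₂ : ∀ m : ℕ, a * b₂ * (q : ℂ) ^ m ≠ 1) (d : ℕ) :
    Summable fun ν : ℕ => ‖weight q a₁ a₂ b₁ b₂ (a * (q : ℂ) ^ ν) * (a * (q : ℂ) ^ ν) ^ d *
      (a * (q : ℂ) ^ ν)‖ := by
  obtain ⟨K, hK⟩ := exists_weight_bound hq0 hq1 a₁ a₂ h₁ h₂
  exact .of_nonneg_of_le (fun _ => norm_nonneg _)
    (fun ν => norm_weight_term_le hq0 hq1 hK.self_of_nhds d ν)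
    ((summable_geometric_of_lt_one hq0.le hq1).mul_left _)

/-- Absolute convergence of both series of the Jackson integral of `f` over `[a, b]`. -/
def JacksonSummable (q : ℝ) (a b : ℂ) (f : ℂ → ℂ) : Prop :=
  ∀ c : ℂ, c = a ∨ c = b → Summable fun ν : ℕ => ‖f (c * (q : ℂ) ^ ν) * (c * (q : ℂ) ^ ν)‖

lemma Admissible.jacksonSummable {q : ℝ} (hq0 : 0 < q) (hq1 : q < 1) {a₁ a₂ b₁ b₂ : ℂ}
    (h : Admissible q a₁ a₂ b₁ b₂) (d : ℕ) :
    JacksonSummable q a₁ a₂ fun z => weight q a₁ a₂ b₁ b₂ z * z ^ d := by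
  rintro c (rfl | rfl)
  · exact summable_weight_term hq0 hq1 _ _ h.h₁₁ h.h₁₂ d
  · exact summable_weight_term hq0 hq1 _ _ h.h₂₁ h.h₂₂ d

lemma jackson_congr {q : ℝ} (hq0 : 0 < q) {a b : ℂ} (ha : a ≠ 0) (hb : b ≠ 0) {f g : ℂ → ℂ}
    (h : ∀ z ≠ 0, f z = g z) : jackson q a b f = jackson q a b g := by
  have hq := ofReal_q_ne_zero hq0
  have : ∀ c ≠ 0, jacksonFromZero q c f = jacksonFromZero q c g := fun c hc => by
    simp only [jacksonFromZero, h _ (mul_ne_zero hc (pow_ne_zero _ hq))]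
  rw [jackson, jackson, this a ha, this b hb]

lemma jackson_sum {ι : Type*} {q : ℝ} {a b : ℂ} (s : Finset ι) (c : ι → ℂ) (f : ι → ℂ → ℂ)
    (hf : ∀ i ∈ s, JacksonSummable q a b (f i)) :
    jackson q a b (fun z => ∑ i ∈ s, c i * f i z) = ∑ i ∈ s, c i * jackson q a b (f i) := by
  have key : ∀ e, e = a ∨ e = b → jacksonFromZero q e (fun z => ∑ i ∈ s, c i * f i z) =
      ∑ i ∈ s, c i * jacksonFromZero q e (f i) := by
    intro e he
    simp only [jacksonFromZero, Finset.sum_mul]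
    rw [Summable.tsum_finsetSum fun i hi => ?_, Finset.mul_sum]
    · refine Finset.sum_congr rfl fun i _ => ?_
      simp only [mul_assoc (c i)]
      rw [tsum_mul_left]
      ring
    · simp only [mul_assoc (c i)]
      exact ((hf i hi e he).of_norm).mul_left _
  simp only [jackson, key a (.inl rfl), key b (.inr rfl), mul_sub, Finset.sum_sub_distrib]

lemma continuousAt_jacksonMoment {q : ℝ} (hq0 : 0 < q) (hq1 : q < 1) {a₁ a₂ b₁ b₂ : ℂ}
    (h : Admissible q a₁ a₂ b₁ b₂) (d : ℕ) :
    ContinuousAt (fun p : ℂ × ℂ => jacksonMoment q a₁ a₂ p.1 p.2 d) (b₁, b₂) := by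
  have key : ∀ a : ℂ, (∀ m : ℕ, a * b₁ * (q : ℂ) ^ m ≠ 1) → (∀ m : ℕ, a * b₂ * (q : ℂ) ^ m ≠ 1) →
      ContinuousAt (fun p : ℂ × ℂ => jacksonFromZero q a fun z =>
        weight q a₁ a₂ p.1 p.2 z * z ^ d) (b₁, b₂) := by
    intro a h₁ h₂
    obtain ⟨K, hK⟩ := exists_weight_bound hq0 hq1 a₁ a₂ h₁ h₂
    refine ContinuousAt.mul continuousAt_const ?_
    refine tendsto_tsum_of_dominated_convergence (bound := fun ν => K * ‖a‖ ^ (d + 1) * q ^ ν)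
      ((summable_geometric_of_lt_one hq0.le hq1).mul_left _) (fun ν => ?_) ?_
    · have hw : ContinuousAt (fun p : ℂ × ℂ => weight q a₁ a₂ p.1 p.2 (a * (q : ℂ) ^ ν))
          (b₁, b₂) :=
        ContinuousAt.comp (f := fun p : ℂ × ℂ => (p, a * (q : ℂ) ^ ν))
          (continuousAt_weight hq0 hq1 a₁ a₂ ((b₁, b₂), a * (q : ℂ) ^ ν)
            (qPochInf_mul_pow_ne_zero hq0 hq1 h₁ ν) (qPochInf_mul_pow_ne_zero hq0 hq1 h₂ ν))
          (by fun_prop)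
      exact (hw.mul continuousAt_const).mul continuousAt_const
    · filter_upwards [hK] with p hp ν
      exact norm_weight_term_le hq0 hq1 hp d ν
  exact (key a₂ h.h₂₁ h.h₂₂).sub (key a₁ h.h₁₁ h.h₁₂)

/-- Multiplying `b₁` by `q^m` multiplies the weight by `(b₁ z)_m`. -/
lemma weight_q_mul {q : ℝ} (hq0 : 0 < q) (hq1 : q < 1) {b₁ z : ℂ} (hz : qPochInf q (b₁ * z) ≠ 0)
    (a₁ a₂ b₂ : ℂ) (m : ℕ) :
    weight q a₁ a₂ ((q : ℂ) ^ m * b₁) b₂ z = weight q a₁ a₂ b₁ b₂ z * qPoch q (b₁ * z) m := by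
  have h := qPochInf_eq_qPoch_mul q hq0 hq1 (b₁ * z) m
  rw [h] at hz
  have h1 := left_ne_zero_of_mul hz
  have h2 := right_ne_zero_of_mul hz
  unfold weight
  rw [h, mul_assoc _ b₁ z]
  generalize qPoch q (b₁ * z) m = A at *
  generalize qPochInf q ((q : ℂ) ^ m * (b₁ * z)) = B at *
  field_simp

/-- The `q`-Pearson relation, in integrated form: the total `q`-difference of
`(z/a₁)_∞ (z/a₂)_∞ / ((b₁z)_∞ (b₂z)_∞)` sums to `-1`. -/
lemma tsum_weight_telescope {q : ℝ} (hq0 : 0 < q) (hq1 : q < 1) {a₁ a₂ b₁ b₂ : ℂ} {a : ℂ}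
    (ha₁ : a₁ ≠ 0) (ha₂ : a₂ ≠ 0) (ha : a = a₁ ∨ a = a₂)
    (h₁ : ∀ m : ℕ, a * b₁ * (q : ℂ) ^ m ≠ 1) (h₂ : ∀ m : ℕ, a * b₂ * (q : ℂ) ^ m ≠ 1) :
    (b₁ + b₂ - a₁⁻¹ - a₂⁻¹) *
        jacksonFromZero q a (fun z => weight q a₁ a₂ b₁ b₂ z * z ^ 0) +
      (a₁⁻¹ * a₂⁻¹ - b₁ * b₂) *
        jacksonFromZero q a (fun z => weight q a₁ a₂ b₁ b₂ z * z ^ 1) =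
      (1 - (q : ℂ)) * (0 - 1) := by
  set ψ : ℂ → ℂ := fun z => qPochInf q (a₁⁻¹ * z) / qPochInf q (b₁ * z) *
    (qPochInf q (a₂⁻¹ * z) / qPochInf q (b₂ * z)) with hψ
  have hc := continuous_qPochInf hq0 hq1
  have hlim : Tendsto (fun ν : ℕ => a * (q : ℂ) ^ ν) atTop (𝓝 0) := by
    simpa using (tendsto_q_pow hq0 hq1).const_mul a
  have hψ0 : Tendsto (fun ν : ℕ => ψ (a * (q : ℂ) ^ ν)) atTop (𝓝 1) := by
    have : ContinuousAt ψ 0 := by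
      refine ContinuousAt.mul (ContinuousAt.div ?_ ?_ ?_) (ContinuousAt.div ?_ ?_ ?_)
      · exact (hc.comp (continuous_const.mul continuous_id)).continuousAt
      · exact (hc.comp (continuous_const.mul continuous_id)).continuousAt
      · simp [qPochInf_zero]
      · exact (hc.comp (continuous_const.mul continuous_id)).continuousAt
      · exact (hc.comp (continuous_const.mul continuous_id)).continuousAt
      · simp [qPochInf_zero]
    have h0 : ψ 0 = 1 := by simp [hψ, qPochInf_zero]
    have := this.tendsto.comp hlim
    rwa [h0] at this
  have hψa : ψ (a * (q : ℂ) ^ 0) = 0 := by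
    have h1 : qPochInf q 1 = 0 := by rw [qPochInf_succ hq0 hq1, sub_self, zero_mul]
    rcases ha with rfl | rfl <;> simp [hψ, ha₁, ha₂, h1]
  have s0 := (summable_weight_term hq0 hq1 a₁ a₂ h₁ h₂ 0).of_norm
  have s1 := (summable_weight_term hq0 hq1 a₁ a₂ h₁ h₂ 1).of_norm
  have hterm : ∀ ν : ℕ, (b₁ + b₂ - a₁⁻¹ - a₂⁻¹) *
        (weight q a₁ a₂ b₁ b₂ (a * (q : ℂ) ^ ν) * (a * (q : ℂ) ^ ν) ^ 0 * (a * (q : ℂ) ^ ν)) +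
      (a₁⁻¹ * a₂⁻¹ - b₁ * b₂) *
        (weight q a₁ a₂ b₁ b₂ (a * (q : ℂ) ^ ν) * (a * (q : ℂ) ^ ν) ^ 1 * (a * (q : ℂ) ^ ν)) =
      ψ (a * (q : ℂ) ^ ν) - ψ (a * (q : ℂ) ^ (ν + 1)) := by
    intro ν
    have n1 := qPochInf_mul_pow_ne_zero hq0 hq1 h₁ ν
    have n2 := qPochInf_mul_pow_ne_zero hq0 hq1 h₂ ν
    have e : a * (q : ℂ) ^ (ν + 1) = q * (a * (q : ℂ) ^ ν) := by ring
    rw [e]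
    generalize a * (q : ℂ) ^ ν = z at *
    have f1 := qPochInf_succ hq0 hq1 (b₁ * z)
    have f2 := qPochInf_succ hq0 hq1 (b₂ * z)
    have g1 := qPochInf_succ hq0 hq1 (a₁⁻¹ * z)
    have g2 := qPochInf_succ hq0 hq1 (a₂⁻¹ * z)
    have e1 : ∀ c : ℂ, (q : ℂ) * (c * z) = c * (q * z) := fun c => by ring
    rw [e1] at f1 f2 g1 g2
    rw [f1] at n1
    rw [f2] at n2
    have n3 := left_ne_zero_of_mul n1
    have n4 := right_ne_zero_of_mul n1
    have n5 := left_ne_zero_of_mul n2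
    have n6 := right_ne_zero_of_mul n2
    simp only [hψ, weight]
    rw [f1, f2, g1, g2, mul_assoc (q : ℂ), mul_assoc (q : ℂ), e1, e1]
    generalize qPochInf q (b₁ * (q * z)) = B1 at *
    generalize qPochInf q (b₂ * (q * z)) = B2 at *
    generalize qPochInf q (a₁⁻¹ * (q * z)) = A1 at *
    generalize qPochInf q (a₂⁻¹ * (q * z)) = A2 at *
    generalize a₁⁻¹ = α at *
    generalize a₂⁻¹ = β at *
    rw [div_mul_div_comm, div_mul_div_comm, div_mul_div_comm,
      show A1 * A2 / (B1 * B2) = A1 * A2 * ((1 - b₁ * z) * (1 - b₂ * z)) /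
        ((1 - b₁ * z) * B1 * ((1 - b₂ * z) * B2)) by
          rw [show (1 - b₁ * z) * B1 * ((1 - b₂ * z) * B2) =
            B1 * B2 * ((1 - b₁ * z) * (1 - b₂ * z)) by ring,
            mul_div_mul_right _ _ (mul_ne_zero n3 n5)], ← sub_div]
    simp only [← mul_div_assoc, div_mul_eq_mul_div, ← add_div]
    congr 1
    ring
  have hs := ((s0.mul_left (b₁ + b₂ - a₁⁻¹ - a₂⁻¹)).add
    (s1.mul_left (a₁⁻¹ * a₂⁻¹ - b₁ * b₂)))
  have ht : ∑' ν : ℕ, ((b₁ + b₂ - a₁⁻¹ - a₂⁻¹) *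
        (weight q a₁ a₂ b₁ b₂ (a * (q : ℂ) ^ ν) * (a * (q : ℂ) ^ ν) ^ 0 * (a * (q : ℂ) ^ ν)) +
      (a₁⁻¹ * a₂⁻¹ - b₁ * b₂) *
        (weight q a₁ a₂ b₁ b₂ (a * (q : ℂ) ^ ν) * (a * (q : ℂ) ^ ν) ^ 1 * (a * (q : ℂ) ^ ν))) =
      0 - 1 := by
    refine tendsto_nhds_unique hs.hasSum.tendsto_sum_nat ?_
    simp only [hterm, Finset.sum_range_sub', hψa]
    exact tendsto_const_nhds.sub hψ0
  rw [Summable.tsum_add (s0.mul_left _) (s1.mul_left _), tsum_mul_left, tsum_mul_left] at ht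
  rw [← ht]
  simp only [jacksonFromZero]
  ring

lemma jacksonMoment_one {q : ℝ} (hq0 : 0 < q) (hq1 : q < 1) {a₁ a₂ b₁ b₂ : ℂ}
    (h : Admissible q a₁ a₂ b₁ b₂) :
    (1 - a₁ * a₂ * b₁ * b₂) * jacksonMoment q a₁ a₂ b₁ b₂ 1 =
      (a₁ + a₂ - a₁ * a₂ * (b₁ + b₂)) * jacksonMoment q a₁ a₂ b₁ b₂ 0 := by
  have e1 := tsum_weight_telescope hq0 hq1 h.a₁_ne h.a₂_ne (.inl rfl) h.h₁₁ h.h₁₂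
  have e2 := tsum_weight_telescope hq0 hq1 h.a₁_ne h.a₂_ne (.inr rfl) h.h₂₁ h.h₂₂
  have c1 : a₁ * a₁⁻¹ = 1 := mul_inv_cancel₀ h.a₁_ne
  have c2 : a₂ * a₂⁻¹ = 1 := mul_inv_cancel₀ h.a₂_ne
  simp only [jacksonMoment, jackson]
  generalize jacksonFromZero q a₁ (fun z => weight q a₁ a₂ b₁ b₂ z * z ^ 0) = A at *
  generalize jacksonFromZero q a₂ (fun z => weight q a₁ a₂ b₁ b₂ z * z ^ 0) = B at *
  generalize jacksonFromZero q a₁ (fun z => weight q a₁ a₂ b₁ b₂ z * z ^ 1) = A' at *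
  generalize jacksonFromZero q a₂ (fun z => weight q a₁ a₂ b₁ b₂ z * z ^ 1) = B' at *
  linear_combination (a₁ * a₂) * (e2 - e1) + (B - A) * (a₂ * c1 + a₁ * c2) -
    (B' - A') * (a₂ * a₂⁻¹ * c1 + c2)

/-- Integration against `(b₁ z)_m` is a shift of `b₁`. -/
lemma jackson_weight_mul_qPoch {q : ℝ} (hq0 : 0 < q) (hq1 : q < 1) {a₁ a₂ b₁ b₂ : ℂ}
    (h : Admissible q a₁ a₂ b₁ b₂) (m : ℕ) :
    jackson q a₁ a₂ (fun z => weight q a₁ a₂ b₁ b₂ z * qPoch q (b₁ * z) m) =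
      jacksonMoment q a₁ a₂ ((q : ℂ) ^ m * b₁) b₂ 0 := by
  simp only [jacksonMoment, jackson, jacksonFromZero, pow_zero, mul_one]
  simp only [weight_q_mul hq0 hq1 (qPochInf_mul_pow_ne_zero hq0 hq1 h.h₁₁ _),
    weight_q_mul hq0 hq1 (qPochInf_mul_pow_ne_zero hq0 hq1 h.h₂₁ _)]

lemma jacksonMoment_q_mul {q : ℝ} (hq0 : 0 < q) (hq1 : q < 1) {a₁ a₂ b₁ b₂ : ℂ}
    (h : Admissible q a₁ a₂ b₁ b₂) :
    (1 - a₁ * a₂ * b₁ * b₂) * jacksonMoment q a₁ a₂ ((q : ℂ) ^ 1 * b₁) b₂ 0 =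
      (1 - a₁ * b₁) * (1 - a₂ * b₁) * jacksonMoment q a₁ a₂ b₁ b₂ 0 := by
  have e1 := jacksonMoment_one hq0 hq1 h
  have e2 : jacksonMoment q a₁ a₂ ((q : ℂ) ^ 1 * b₁) b₂ 0 =
      jacksonMoment q a₁ a₂ b₁ b₂ 0 - b₁ * jacksonMoment q a₁ a₂ b₁ b₂ 1 := by
    rw [← jackson_weight_mul_qPoch hq0 hq1 h]
    have := jackson_sum (q := q) (a := a₁) (b := a₂) (Finset.univ : Finset (Fin 2)) ![1, -b₁]
      (fun i z => weight q a₁ a₂ b₁ b₂ z * z ^ (i : ℕ)) fun i _ => h.jacksonSummable hq0 hq1 i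
    simp only [Fin.sum_univ_two, Matrix.cons_val_zero, Matrix.cons_val_one, Fin.val_zero,
      Fin.val_one] at this
    have e3 : (fun z => weight q a₁ a₂ b₁ b₂ z * qPoch q (b₁ * z) 1) = fun z =>
        1 * (weight q a₁ a₂ b₁ b₂ z * z ^ 0) + -b₁ * (weight q a₁ a₂ b₁ b₂ z * z ^ 1) := by
      funext z
      simp only [qPoch, Finset.prod_range_one, pow_zero]
      ring
    rw [e3, this]
    simp only [jacksonMoment]
    ring
  rw [e2]
  linear_combination -b₁ * e1

lemma qPoch_mul_jacksonMoment {q : ℝ} (hq0 : 0 < q) (hq1 : q < 1) {a₁ a₂ b₁ b₂ : ℂ}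
    (h : Admissible q a₁ a₂ b₁ b₂) (m : ℕ) :
    qPoch q (a₁ * a₂ * b₁ * b₂) m * jacksonMoment q a₁ a₂ ((q : ℂ) ^ m * b₁) b₂ 0 =
      qPoch q (a₁ * b₁) m * qPoch q (a₂ * b₁) m * jacksonMoment q a₁ a₂ b₁ b₂ 0 := by
  induction m with
  | zero => simp [qPoch]
  | succ m ih =>
    have e := jacksonMoment_q_mul hq0 hq1 (h.q_mul m)
    have e2 : (q : ℂ) ^ (m + 1) * b₁ = (q : ℂ) ^ 1 * ((q : ℂ) ^ m * b₁) := by ring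
    rw [qPoch_succ, qPoch_succ, qPoch_succ, e2]
    linear_combination qPoch q (a₁ * a₂ * b₁ * b₂) m * e +
      (1 - (q : ℂ) ^ m * (a₁ * b₁)) * (1 - (q : ℂ) ^ m * (a₂ * b₁)) * ih

/-- The limit `m → ∞` of `qPoch_mul_jacksonMoment`. -/
lemma jacksonMoment_zero_left {q : ℝ} (hq0 : 0 < q) (hq1 : q < 1) {a₁ a₂ b₁ b₂ : ℂ}
    (h : Admissible q a₁ a₂ b₁ b₂) :
    qPochInf q (a₁ * a₂ * b₁ * b₂) * jacksonMoment q a₁ a₂ 0 b₂ 0 =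
      qPochInf q (a₁ * b₁) * qPochInf q (a₂ * b₁) * jacksonMoment q a₁ a₂ b₁ b₂ 0 := by
  have hl : Tendsto (fun m : ℕ => ((q : ℂ) ^ m * b₁, b₂)) atTop (𝓝 (0, b₂)) := by
    refine Tendsto.prodMk_nhds ?_ tendsto_const_nhds
    simpa using (tendsto_q_pow hq0 hq1).mul_const b₁
  have h1 := (continuousAt_jacksonMoment hq0 hq1 h.zero_left 0).tendsto.comp hl
  have h2 := (tendsto_qPoch hq0 hq1 (a₁ * a₂ * b₁ * b₂)).mul h1
  refine tendsto_nhds_unique h2 ?_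
  simp only [Function.comp_def, qPoch_mul_jacksonMoment hq0 hq1 h]
  exact ((tendsto_qPoch hq0 hq1 _).mul (tendsto_qPoch hq0 hq1 _)).mul tendsto_const_nhds

lemma jacksonMoment_eq_base {q : ℝ} (hq0 : 0 < q) (hq1 : q < 1) {a₁ a₂ b₁ b₂ : ℂ}
    (h : Admissible q a₁ a₂ b₁ b₂) :
    qPochInf q (a₁ * b₁) * qPochInf q (a₂ * b₁) * (qPochInf q (a₁ * b₂) * qPochInf q (a₂ * b₂)) *
      jacksonMoment q a₁ a₂ b₁ b₂ 0 =
      qPochInf q (a₁ * a₂ * b₁ * b₂) * jacksonMoment q a₁ a₂ 0 0 0 := by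
  have e1 := jacksonMoment_zero_left hq0 hq1 h
  have e2 := jacksonMoment_zero_left hq0 hq1 h.zero_left.swap
  rw [mul_zero, qPochInf_zero, one_mul, jacksonMoment_swap q a₁ a₂ b₂ 0] at e2
  linear_combination -qPochInf q (a₁ * b₂) * qPochInf q (a₂ * b₂) * e1 -
    qPochInf q (a₁ * a₂ * b₁ * b₂) * e2

lemma jacksonFromZero_eq_of_vanish {q : ℝ} {a a' : ℂ} {k : ℕ} (h : a' = a * (q : ℂ) ^ k)
    {f : ℂ → ℂ} (hf : ∀ ν < k, f (a * (q : ℂ) ^ ν) = 0) :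
    jacksonFromZero q a f = jacksonFromZero q a' f := by
  unfold jacksonFromZero
  congr 1
  rw [← (add_left_injective k).tsum_eq (f := fun ν : ℕ =>
    f (a * (q : ℂ) ^ ν) * (a * (q : ℂ) ^ ν))]
  · refine tsum_congr fun ν => ?_
    have : a * (q : ℂ) ^ (ν + k) = a' * (q : ℂ) ^ ν := by rw [h]; ring
    simp only [this]
  · intro ν hν
    by_contra hlt
    have : ν < k := by
      by_contra hk
      exact hlt ⟨ν - k, Nat.sub_add_cancel (not_lt.mp hk)⟩
    exact hν (by simp [hf ν this])

/-- The case `b₁ = b₂ = 0`. If `a₁ / a₂` is not a power of `q`, the constant is read off at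
`b_i = q / a_i`, where the weight is `1`; otherwise both sides vanish. -/
lemma jacksonMoment_base {q : ℝ} (hq0 : 0 < q) (hq1 : q < 1) {a₁ a₂ : ℂ} (ha₁ : a₁ ≠ 0)
    (ha₂ : a₂ ≠ 0) :
    jacksonMoment q a₁ a₂ 0 0 0 = (1 - (q : ℂ)) * (a₂ * qPochInf q q * theta q (a₁ / a₂)) := by
  have hq := ofReal_q_ne_zero hq0
  by_cases hA : ∃ k : ℕ, a₁ = a₂ * (q : ℂ) ^ k
  · obtain ⟨k, hk⟩ := hA
    have hJ : jacksonMoment q a₁ a₂ 0 0 0 = 0 := by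
      rw [jacksonMoment, jackson, jacksonFromZero_eq_of_vanish hk, sub_self]
      intro ν hν
      have : qPochInf q ((q : ℂ) * a₁⁻¹ * (a₂ * (q : ℂ) ^ ν)) = 0 := by
        refine qPochInf_eq_zero hq0 hq1 (m := k - ν - 1) ?_
        have e : (q : ℂ) ^ k = (q : ℂ) ^ (k - ν - 1) * (q : ℂ) ^ ν * q := by
          rw [← pow_add, ← pow_succ]; congr 1; omega
        rw [hk, e]
        field_simp
      simp [weight, this]
    have hθ : theta q (a₁ / a₂) = 0 := by
      rw [theta, hk, mul_div_cancel_left₀ _ ha₂]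
      rcases k with _ | k
      · rw [pow_zero, qPochInf_eq_zero hq0 hq1 (m := 0) (by simp), zero_mul]
      · rw [qPochInf_eq_zero hq0 hq1 (a := (q : ℂ) / _) (m := k)
          (by rw [pow_succ]; field_simp), mul_zero]
    rw [hJ, hθ, mul_zero, mul_zero]
  by_cases hB : ∃ k : ℕ, a₂ = a₁ * (q : ℂ) ^ k
  · obtain ⟨k, hk⟩ := hB
    have hJ : jacksonMoment q a₁ a₂ 0 0 0 = 0 := by
      rw [jacksonMoment, jackson, jacksonFromZero_eq_of_vanish (a := a₁) hk, sub_self]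
      intro ν hν
      have : qPochInf q ((q : ℂ) * a₂⁻¹ * (a₁ * (q : ℂ) ^ ν)) = 0 := by
        refine qPochInf_eq_zero hq0 hq1 (m := k - ν - 1) ?_
        have e : (q : ℂ) ^ k = (q : ℂ) ^ (k - ν - 1) * (q : ℂ) ^ ν * q := by
          rw [← pow_add, ← pow_succ]; congr 1; omega
        rw [hk, e]
        field_simp
      simp [weight, this]
    have hθ : theta q (a₁ / a₂) = 0 := by
      rw [theta, qPochInf_eq_zero hq0 hq1 (a := a₁ / a₂) (m := k)
        (by rw [hk]; field_simp), zero_mul]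
    rw [hJ, hθ, mul_zero, mul_zero]
  · have hA' : ∀ m : ℕ, a₂ * ((q : ℂ) * a₁⁻¹) * (q : ℂ) ^ m ≠ 1 := fun m e =>
      hA ⟨m + 1, by field_simp at e; rw [← e]; ring⟩
    have hB' : ∀ m : ℕ, a₁ * ((q : ℂ) * a₂⁻¹) * (q : ℂ) ^ m ≠ 1 := fun m e =>
      hB ⟨m + 1, by field_simp at e; rw [← e]; ring⟩
    have hC : ∀ a : ℂ, a ≠ 0 → ∀ m : ℕ, a * ((q : ℂ) * a⁻¹) * (q : ℂ) ^ m ≠ 1 := by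
      intro a ha m e
      refine q_pow_ne_one hq0 hq1 m.succ_ne_zero ?_
      rw [← e, pow_succ]
      field_simp
    have hadm : Admissible q a₁ a₂ ((q : ℂ) * a₁⁻¹) ((q : ℂ) * a₂⁻¹) :=
      ⟨ha₁, ha₂, hC a₁ ha₁, hB', hA', hC a₂ ha₂⟩
    have hgeom : ∀ a : ℂ, (∀ m : ℕ, a * ((q : ℂ) * a₁⁻¹) * (q : ℂ) ^ m ≠ 1) →
        (∀ m : ℕ, a * ((q : ℂ) * a₂⁻¹) * (q : ℂ) ^ m ≠ 1) →
        jacksonFromZero q a (fun z =>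
          weight q a₁ a₂ ((q : ℂ) * a₁⁻¹) ((q : ℂ) * a₂⁻¹) z * z ^ 0) = a := by
      intro a h1 h2
      have hw : ∀ ν : ℕ, weight q a₁ a₂ ((q : ℂ) * a₁⁻¹) ((q : ℂ) * a₂⁻¹) (a * (q : ℂ) ^ ν) = 1 :=
        fun ν => by
          rw [weight, div_self (qPochInf_mul_pow_ne_zero hq0 hq1 h1 ν),
            div_self (qPochInf_mul_pow_ne_zero hq0 hq1 h2 ν), one_mul]
      have hn : (1 : ℂ) - q ≠ 0 := sub_ne_zero.mpr (by
        simpa using (q_pow_ne_one hq0 hq1 one_ne_zero).symm)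
      simp only [jacksonFromZero, hw, pow_zero, one_mul]
      rw [tsum_mul_left, tsum_geometric_of_norm_lt_one (by
        rwa [Complex.norm_real, Real.norm_eq_abs, abs_of_pos hq0])]
      field_simp
    have hJ : jacksonMoment q a₁ a₂ ((q : ℂ) * a₁⁻¹) ((q : ℂ) * a₂⁻¹) 0 = a₂ - a₁ := by
      rw [jacksonMoment, jackson, hgeom a₁ hadm.h₁₁ hadm.h₁₂, hgeom a₂ hadm.h₂₁ hadm.h₂₂]
    have key := jacksonMoment_eq_base hq0 hq1 hadm
    rw [hJ] at key
    have n1 := qPochInf_q_ne_zero hq0 hq1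
    have e1 : a₁ * ((q : ℂ) * a₁⁻¹) = q := by field_simp
    have e2 : a₂ * ((q : ℂ) * a₂⁻¹) = q := by field_simp
    have e3 : a₁ * a₂ * ((q : ℂ) * a₁⁻¹) * ((q : ℂ) * a₂⁻¹) = q * q := by field_simp
    have e4 : a₁ * ((q : ℂ) * a₂⁻¹) = q * (a₁ / a₂) := by ring
    have e5 : a₂ * ((q : ℂ) * a₁⁻¹) = q / (a₁ / a₂) := by field_simp
    have e6 := qPochInf_succ hq0 hq1 (a₁ / a₂)
    have e7 := qPochInf_succ hq0 hq1 (q : ℂ)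
    rw [e1, e2, e3, e4, e5] at key
    rw [e7] at n1 key
    have n2 := right_ne_zero_of_mul n1
    rw [theta, e6, e7]
    have e8 : a₂ * (1 - a₁ / a₂) = a₂ - a₁ := by field_simp
    refine mul_left_cancel₀ n2 ?_
    rw [← key]
    linear_combination (-(1 - (q : ℂ)) ^ 2 * qPochInf q (q * q) ^ 2 *
      qPochInf q (q * (a₁ / a₂)) * qPochInf q (q / (a₁ / a₂))) * e8

/-- The moments of the weight, relative to the total mass. -/
lemma jacksonMoment_eq_newtonMoment {q : ℝ} (hq0 : 0 < q) (hq1 : q < 1) {a₁ a₂ b₁ b₂ : ℂ}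
    (h : Admissible q a₁ a₂ b₁ b₂) (hY : ∀ m : ℕ, a₁ * a₂ * b₁ * b₂ * (q : ℂ) ^ m ≠ 1) (d : ℕ) :
    b₁ ^ d * jacksonMoment q a₁ a₂ b₁ b₂ d =
      newtonMoment q (fun m => qPoch q (a₁ * b₁) m * qPoch q (a₂ * b₁) m /
        qPoch q (a₁ * a₂ * b₁ * b₂) m) d * jacksonMoment q a₁ a₂ b₁ b₂ 0 := by
  have hS : ∀ m, JacksonSummable q a₁ a₂
      fun z => weight q a₁ a₂ b₁ b₂ z * qPoch q (b₁ * z) m := by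
    intro m c hc
    have := (h.q_mul m).jacksonSummable hq0 hq1 0 c hc
    simp only [pow_zero, mul_one] at this
    rcases hc with rfl | rfl
    · simpa only [weight_q_mul hq0 hq1 (qPochInf_mul_pow_ne_zero hq0 hq1 h.h₁₁ _)] using this
    · simpa only [weight_q_mul hq0 hq1 (qPochInf_mul_pow_ne_zero hq0 hq1 h.h₂₁ _)] using this
  have e1 : b₁ ^ d * jacksonMoment q a₁ a₂ b₁ b₂ d =
      jackson q a₁ a₂ (fun z => weight q a₁ a₂ b₁ b₂ z * (b₁ * z) ^ d) := by
    have := jackson_sum (q := q) (a := a₁) (b := a₂) (Finset.univ : Finset (Fin 1))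
      (fun _ => b₁ ^ d) (fun _ z => weight q a₁ a₂ b₁ b₂ z * z ^ d)
      fun _ _ => h.jacksonSummable hq0 hq1 d
    simp only [Fin.sum_univ_one] at this
    rw [jacksonMoment, ← this]
    congr 1
    funext z
    ring
  have e2 : (fun z => weight q a₁ a₂ b₁ b₂ z * (b₁ * z) ^ d) = fun z =>
      ∑ m ∈ Finset.range (d + 1), newtonCoeff q d m *
        (weight q a₁ a₂ b₁ b₂ z * qPoch q (b₁ * z) m) := by
    funext z
    have := congrArg (Polynomial.eval (b₁ * z))
      (pow_eq_sum_newtonCoeff hq0 hq1 d (d + 1) (Nat.lt_succ_self d))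
    rw [eval_pow, eval_X, eval_finsetSum] at this
    rw [this, Finset.mul_sum]
    refine Finset.sum_congr rfl fun m _ => ?_
    rw [eval_mul, eval_C, eval_qPochPoly]
    ring
  rw [e1, e2, jackson_sum _ _ _ fun m _ => hS m, newtonMoment, Finset.sum_mul]
  refine Finset.sum_congr rfl fun m _ => ?_
  have hn : qPoch q (a₁ * a₂ * b₁ * b₂) m ≠ 0 := qPoch_ne_zero fun k _ => hY k
  rw [jackson_weight_mul_qPoch hq0 hq1 h, smul_eq_mul, mul_assoc, div_mul_eq_mul_div,
    ← qPoch_mul_jacksonMoment hq0 hq1 h, mul_div_cancel_left₀ _ hn]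

/-! ### Product functionals on multivariate polynomials -/

/-- The value on `P` of the product of the linear functionals on `ℂ[z_i]` with moments
`z_i ^ d ↦ lam i d`. -/
def momentFunctional {n : ℕ} {A : Type*} [CommRing A] [Algebra ℂ A] (lam : Fin n → ℕ → A)
    (P : MvPolynomial (Fin n) ℂ) : A :=
  ∑ d ∈ P.support, P.coeff d • ∏ i, lam i (d i)

lemma map_momentFunctional {n : ℕ} {A B : Type*} [CommRing A] [Algebra ℂ A] [CommRing B]
    [Algebra ℂ B] (φ : A →ₐ[ℂ] B) (lam : Fin n → ℕ → A) (P : MvPolynomial (Fin n) ℂ) :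
    φ (momentFunctional lam P) = momentFunctional (fun i d => φ (lam i d)) P := by
  simp only [momentFunctional, map_sum, map_smul, map_prod]

lemma map_newtonMoment (q : ℝ) {A B : Type*} [CommRing A] [Algebra ℂ A] [CommRing B]
    [Algebra ℂ B] (φ : A →ₐ[ℂ] B) (e : ℕ → A) (d : ℕ) :
    φ (newtonMoment q e d) = newtonMoment q (fun m => φ (e m)) d := by
  simp only [newtonMoment, map_sum, map_smul]

/-- A functional given by finitely supported measures is a sum over the product of the
supports. -/
lemma momentFunctional_eq_sum_eval {n : ℕ} {κ : Type*} [DecidableEq κ] (S : Fin n → Finset κ)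
    (w u : Fin n → κ → ℂ) (P : MvPolynomial (Fin n) ℂ) :
    momentFunctional (fun i d => ∑ s ∈ S i, w i s * u i s ^ d) P =
      ∑ ν ∈ Fintype.piFinset S, (∏ i, w i (ν i)) * MvPolynomial.eval (fun i => u i (ν i)) P := by
  simp only [momentFunctional, MvPolynomial.eval_eq', Finset.prod_univ_sum, Finset.mul_sum,
    smul_eq_mul]
  rw [Finset.sum_comm]
  refine Finset.sum_congr rfl fun ν _ => Finset.sum_congr rfl fun d _ => ?_
  rw [Finset.prod_mul_distrib]
  ring

lemma apply_le_totalDegree {n : ℕ} {P : MvPolynomial (Fin n) ℂ} {d : Fin n →₀ ℕ}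
    (hd : d ∈ P.support) (i : Fin n) : d i ≤ P.totalDegree :=
  ((MvPolynomial.degreeOf_le_iff.mp le_rfl) d hd).trans (MvPolynomial.degreeOf_le_totalDegree P i)

/-- The coefficient of `∏ i, (z_i)_{m i}` in the expansion of `P`. -/
def newtonCoeffMulti (q : ℝ) {n : ℕ} (P : MvPolynomial (Fin n) ℂ) (m : Fin n → ℕ) : ℂ :=
  momentFunctional (fun i d => newtonCoeff q d (m i)) P

lemma momentFunctional_newtonMoment {q : ℝ} (hq0 : 0 < q) {n : ℕ} {A : Type*} [CommRing A]
    [Algebra ℂ A] (e : ℕ → A) (P : MvPolynomial (Fin n) ℂ) :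
    momentFunctional (fun _ => newtonMoment q e) P =
      ∑ m ∈ Fintype.piFinset fun _ : Fin n => Finset.range (P.totalDegree + 1),
        newtonCoeffMulti q P m • ∏ i, e (m i) := by
  have h1 : ∀ d ∈ P.support, P.coeff d • ∏ i, newtonMoment q e (d i) =
      ∑ m ∈ Fintype.piFinset fun _ : Fin n => Finset.range (P.totalDegree + 1),
        (P.coeff d * ∏ i, newtonCoeff q (d i) (m i)) • ∏ i, e (m i) := by
    intro d hd
    have h2 : ∀ i, newtonMoment q e (d i) =
        ∑ m ∈ Finset.range (P.totalDegree + 1), newtonCoeff q (d i) m • e m := fun i =>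
      newtonMoment_eq_sum hq0 e (Nat.lt_succ_of_le (apply_le_totalDegree hd i))
    simp only [h2, Finset.prod_univ_sum, Finset.smul_sum]
    refine Finset.sum_congr rfl fun m _ => ?_
    rw [Finset.prod_smul, smul_smul]
  rw [momentFunctional, Finset.sum_congr rfl h1, Finset.sum_comm]
  simp only [← Finset.sum_smul, newtonCoeffMulti, momentFunctional, smul_eq_mul]

/-- A Newton coefficient is a combination of values of `P` at nodes of no larger index. -/
lemma exists_eval_ne_zero_of_newtonCoeffMulti {q : ℝ} {n : ℕ} {P : MvPolynomial (Fin n) ℂ}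
    {m : Fin n → ℕ} (h : newtonCoeffMulti q P m ≠ 0) :
    ∃ ν : Fin n → ℕ, (∀ i, ν i ≤ m i) ∧
      MvPolynomial.eval (fun i => ((q : ℂ) ^ ν i)⁻¹) P ≠ 0 := by
  have h1 : ∀ d k : ℕ, newtonCoeff q d k = ∑ ν ∈ Finset.range (k + 1),
      ((q : ℂ) ^ k / qPoch q (q : ℂ) k * (qPochPoly q k).coeff ν) * (((q : ℂ) ^ ν)⁻¹) ^ d := by
    intro d k
    rw [newtonCoeff, ← eval_qPochPoly q k (((q : ℂ) ^ d)⁻¹), eval_eq_sum_range'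
      (Nat.lt_succ_of_le (natDegree_qPochPoly_le q k)), Finset.mul_sum]
    refine Finset.sum_congr rfl fun ν _ => ?_
    rw [inv_pow, inv_pow, ← pow_mul, ← pow_mul, mul_comm d ν]
    ring
  unfold newtonCoeffMulti at h
  simp only [h1] at h
  rw [momentFunctional_eq_sum_eval (fun i => Finset.range (m i + 1))
    (fun i ν => (q : ℂ) ^ m i / qPoch q (q : ℂ) (m i) * (qPochPoly q (m i)).coeff ν)
    (fun _ ν => ((q : ℂ) ^ ν)⁻¹)] at h
  obtain ⟨ν, hν, hne⟩ := Finset.exists_ne_zero_of_sum_ne_zero h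
  refine ⟨ν, fun i => ?_, right_ne_zero_of_mul hne⟩
  have := Fintype.mem_piFinset.mp hν i
  exact Nat.lt_succ_iff.mp (Finset.mem_range.mp this)

lemma natDegree_prod_le_sum {ι : Type*} (s : Finset ι) (f : ι → ℂ[X]) (k : ι → ℕ)
    (h : ∀ i ∈ s, (f i).natDegree ≤ k i) : (∏ i ∈ s, f i).natDegree ≤ ∑ i ∈ s, k i :=
  (natDegree_prod_le s f).trans (Finset.sum_le_sum h)

lemma coeff_prod_sum {ι : Type*} (s : Finset ι) (f : ι → ℂ[X]) (k : ι → ℕ)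
    (h : ∀ i ∈ s, (f i).natDegree ≤ k i) :
    (∏ i ∈ s, f i).coeff (∑ i ∈ s, k i) = ∏ i ∈ s, (f i).coeff (k i) := by
  classical
  induction s using Finset.induction_on with
  | empty => simp
  | insert a s ha ih =>
    have h' : ∀ i ∈ s, (f i).natDegree ≤ k i := fun i hi => h i (Finset.mem_insert_of_mem hi)
    rw [Finset.prod_insert ha, Finset.sum_insert ha, Finset.prod_insert ha,
      coeff_mul_add_eq_of_natDegree_le (h a (Finset.mem_insert_self a s))
        (natDegree_prod_le_sum s f k h'), ih h']

lemma sum_eq_of_isHomogeneous {n D : ℕ} {P : MvPolynomial (Fin n) ℂ} (hP : P.IsHomogeneous D)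
    {d : Fin n →₀ ℕ} (hd : d ∈ P.support) : ∑ i, d i = D := by
  have := hP (MvPolynomial.mem_support_iff.mp hd)
  rw [← this, Finsupp.weight_apply, Finsupp.sum_fintype _ _ (by simp)]
  simp

lemma natDegree_momentFunctional_le {n D : ℕ} {P : MvPolynomial (Fin n) ℂ}
    (hP : P.IsHomogeneous D) (lam : Fin n → ℕ → ℂ[X]) (hl : ∀ i d, (lam i d).natDegree ≤ d) :
    (momentFunctional lam P).natDegree ≤ D := by
  refine natDegree_sum_le_of_forall_le _ _ fun d hd => (natDegree_smul_le _ _).trans ?_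
  rw [← sum_eq_of_isHomogeneous hP hd]
  exact natDegree_prod_le_sum _ _ _ fun i _ => hl i (d i)

lemma coeff_momentFunctional {n D : ℕ} {P : MvPolynomial (Fin n) ℂ}
    (hP : P.IsHomogeneous D) (lam : Fin n → ℕ → ℂ[X]) (hl : ∀ i d, (lam i d).natDegree ≤ d) :
    (momentFunctional lam P).coeff D = momentFunctional (fun i d => (lam i d).coeff d) P := by
  rw [momentFunctional, momentFunctional, finsetSum_coeff]
  refine Finset.sum_congr rfl fun d hd => ?_
  rw [coeff_smul]
  congr 1
  rw [← coeff_prod_sum _ _ _ fun i _ => hl i (d i), sum_eq_of_isHomogeneous hP hd]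

lemma momentFunctional_mul_pow {n D : ℕ} {P : MvPolynomial (Fin n) ℂ}
    (hP : P.IsHomogeneous D) (lam : Fin n → ℕ → ℂ) (r : ℂ) :
    momentFunctional (fun i d => r ^ d * lam i d) P = r ^ D * momentFunctional lam P := by
  rw [momentFunctional, momentFunctional, Finset.mul_sum]
  refine Finset.sum_congr rfl fun d hd => ?_
  rw [Finset.prod_mul_distrib, Finset.prod_pow_eq_pow_sum, sum_eq_of_isHomogeneous hP hd,
    smul_eq_mul, smul_eq_mul]
  ring

lemma momentFunctional_mul_const {n : ℕ} (P : MvPolynomial (Fin n) ℂ) (lam : Fin n → ℕ → ℂ)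
    (r : ℂ) : momentFunctional (fun i d => lam i d * r) P = momentFunctional lam P * r ^ n := by
  rw [momentFunctional, momentFunctional, Finset.sum_mul]
  refine Finset.sum_congr rfl fun d _ => ?_
  rw [Finset.prod_mul_distrib, Finset.prod_const, Finset.card_univ, Fintype.card_fin,
    smul_eq_mul, smul_eq_mul, mul_assoc]

lemma natDegree_newtonMoment_le (q : ℝ) (c : ℕ → ℂ) (d : ℕ) :
    (newtonMoment q (fun m => qPochPoly q m * C (c m)) d).natDegree ≤ d := by
  refine natDegree_sum_le_of_forall_le _ _ fun m hm => (natDegree_smul_le _ _).trans ?_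
  exact (natDegree_mul_C_le _ _).trans ((natDegree_qPochPoly_le q m).trans
    (Nat.lt_succ_iff.mp (Finset.mem_range.mp hm)))

lemma coeff_newtonMoment {q : ℝ} (hq0 : 0 < q) (hq1 : q < 1) (c : ℕ → ℂ) (d : ℕ) :
    (newtonMoment q (fun m => qPochPoly q m * C (c m)) d).coeff d = c d := by
  have hlow : ∀ m ∈ Finset.range d, (qPochPoly q m).coeff d = 0 := fun m hm =>
    coeff_eq_zero_of_natDegree_lt
      ((natDegree_qPochPoly_le q m).trans_lt (Finset.mem_range.mp hm))
  have h1 := congrArg (fun p => p.coeff d)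
    (pow_eq_sum_newtonCoeff hq0 hq1 d (d + 1) (Nat.lt_succ_self d))
  simp only [coeff_X_pow_self, finsetSum_coeff, coeff_C_mul] at h1
  rw [Finset.sum_range_succ, Finset.sum_eq_zero fun m hm => by rw [hlow m hm, mul_zero],
    zero_add] at h1
  rw [newtonMoment, finsetSum_coeff]
  simp only [coeff_smul, coeff_mul_C, smul_eq_mul]
  rw [Finset.sum_range_succ, Finset.sum_eq_zero fun m hm => by
    rw [hlow m hm, zero_mul, mul_zero], zero_add, ← mul_assoc, ← h1, one_mul]

/-! ### The `q`-discriminant -/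

/-- The symmetric polynomial `∏_{j ≠ k} ∏_{0 ≤ s < τ} (z_j - q^s z_k)`, which is
`∏_i z_i^((n-1)τ) ∏_{j<k} (z_j/z_k)_τ (z_k/z_j)_τ`. -/
def selbergPoly (q : ℝ) (n τ : ℕ) : MvPolynomial (Fin n) ℂ :=
  ∏ j, ∏ k ∈ ({j}ᶜ : Finset (Fin n)), ∏ s ∈ Finset.range τ,
    (MvPolynomial.X j - MvPolynomial.C ((q : ℂ) ^ s) * MvPolynomial.X k)

/-- Half of the degree of `selbergPoly`. -/
def halfDegree (n τ : ℕ) : ℕ := ∑ j : Fin n, (j : ℕ) * τ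

lemma eval_selbergPoly (q : ℝ) (n τ : ℕ) (z : Fin n → ℂ) :
    MvPolynomial.eval z (selbergPoly q n τ) =
      ∏ j, ∏ k ∈ ({j}ᶜ : Finset (Fin n)), ∏ s ∈ Finset.range τ, (z j - (q : ℂ) ^ s * z k) := by
  simp [selbergPoly, map_prod]

lemma halfDegree_mul_two (n τ : ℕ) : halfDegree n τ * 2 = n * ((n - 1) * τ) := by
  rw [halfDegree, Fin.sum_univ_eq_sum_range (fun j => j * τ), ← Finset.sum_mul,
    mul_right_comm, Finset.sum_range_id_mul_two, mul_assoc]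

lemma isHomogeneous_selbergPoly (q : ℝ) (n τ : ℕ) :
    (selbergPoly q n τ).IsHomogeneous (halfDegree n τ * 2) := by
  have hd : halfDegree n τ * 2 =
      ∑ j : Fin n, ∑ k ∈ ({j}ᶜ : Finset (Fin n)), ∑ s ∈ Finset.range τ, 1 := by
    rw [halfDegree_mul_two]
    simp [Finset.card_compl]
  rw [hd]
  refine .prod _ _ _ fun j _ => .prod _ _ _ fun k _ => .prod _ _ _ fun s _ => ?_
  refine (MvPolynomial.isHomogeneous_X ℂ j).sub ?_
  simpa using (MvPolynomial.isHomogeneous_C (Fin n) ((q : ℂ) ^ s)).mul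
    (MvPolynomial.isHomogeneous_X ℂ k)

lemma eval_selbergPoly_perm (q : ℝ) (n τ : ℕ) (z : Fin n → ℂ) (σ : Equiv.Perm (Fin n)) :
    MvPolynomial.eval (fun i => z (σ i)) (selbergPoly q n τ) =
      MvPolynomial.eval z (selbergPoly q n τ) := by
  rw [eval_selbergPoly, eval_selbergPoly, ← Equiv.prod_comp σ (fun j =>
    ∏ k ∈ ({j}ᶜ : Finset (Fin n)), ∏ s ∈ Finset.range τ, (z j - (q : ℂ) ^ s * z k))]
  refine Finset.prod_congr rfl fun j _ => ?_
  refine Finset.prod_bij (fun k _ => σ k) ?_ ?_ ?_ ?_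
  · simp
  · intro _ _ _ _ h; exact σ.injective h
  · intro k hk
    refine ⟨σ.symm k, ?_, by simp⟩
    simp only [Finset.mem_compl, Finset.mem_singleton] at hk ⊢
    rintro rfl
    simp at hk
  · intro _ _; rfl

/-- `selbergPoly` vanishes at `(r^{ν_i})` with `r = q` or `r = q⁻¹`, unless the exponents are
`τ`-separated. -/
lemma separated_of_eval_ne_zero {q : ℝ} (hq0 : 0 < q) {n τ : ℕ} {ν : Fin n → ℕ} {r : ℂ}
    (hr : r = q ∨ r = (q : ℂ)⁻¹)
    (h : MvPolynomial.eval (fun i => r ^ ν i) (selbergPoly q n τ) ≠ 0) (i j : Fin n)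
    (hij : i ≠ j) : ν i + τ ≤ ν j ∨ ν j + τ ≤ ν i := by
  have hq := ofReal_q_ne_zero hq0
  have key : ∀ i j : Fin n, i ≠ j → ν i ≤ ν j → ν j < ν i + τ → False := by
    intro i j hij h1 h2
    refine h ?_
    rw [eval_selbergPoly]
    have e : (q : ℂ) ^ ν j = (q : ℂ) ^ (ν j - ν i) * (q : ℂ) ^ ν i := by
      rw [← pow_add, Nat.sub_add_cancel h1]
    have hs : ν j - ν i ∈ Finset.range τ := Finset.mem_range.mpr (by omega)
    rcases hr with rfl | rfl
    · refine Finset.prod_eq_zero (Finset.mem_univ j) (Finset.prod_eq_zero (i := i)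
        (by simpa using hij) (Finset.prod_eq_zero hs ?_))
      rw [e, sub_self]
    · refine Finset.prod_eq_zero (Finset.mem_univ i) (Finset.prod_eq_zero (i := j)
        (by simpa using hij.symm) (Finset.prod_eq_zero hs ?_))
      simp only [inv_pow]
      rw [e]
      field_simp
      ring
  by_contra hcon
  push Not at hcon
  rcases le_total (ν i) (ν j) with hle | hle
  · exact key i j hij hle hcon.1
  · exact key j i hij.symm hle hcon.2

/-- Sorted in increasing order, a `τ`-separated sequence grows by at least `τ` at each step. -/
lemma exists_perm_of_separated {n τ : ℕ} {ν : Fin n → ℕ}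
    (h : ∀ i j, i ≠ j → ν i + τ ≤ ν j ∨ ν j + τ ≤ ν i) :
    ∃ σ : Equiv.Perm (Fin n), ∀ (k : ℕ) (i j : Fin n), (j : ℕ) = i + k →
      ν (σ i) + k * τ ≤ ν (σ j) := by
  refine ⟨Tuple.sort ν, fun k => ?_⟩
  have hm : Monotone (ν ∘ Tuple.sort ν) := Tuple.monotone_sort ν
  induction k with
  | zero =>
    intro i j hij
    have : i = j := Fin.ext (by omega)
    simp [this]
  | succ k ih =>
    intro i j hij
    have hj := j.isLt
    have h1 := ih i ⟨i + k, by omega⟩ rfl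
    have hlt : (⟨i + k, by omega⟩ : Fin n) < j := Fin.lt_def.mpr (by simp only; omega)
    have h2 := hm hlt.le
    simp only [Function.comp_apply] at h2
    have h3 := h _ _ ((Tuple.sort ν).injective.ne hlt.ne)
    have h4 : (k + 1) * τ = k * τ + τ := by ring
    omega

/-- The product `∏_{0 ≤ j < n} (X)_{jτ}`. -/
def lowerFactor (q : ℝ) (n τ : ℕ) : ℂ[X] := ∏ j : Fin n, qPochPoly q (j * τ)

/-- In a functional that is diagonal on the Newton basis, only the indices lying above a
`τ`-separated sequence contribute, and these produce the factor `∏_j (x)_{jτ}`. -/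
lemma lowerFactor_dvd {q : ℝ} (hq0 : 0 < q) (n τ : ℕ) (c : ℕ → ℂ) :
    lowerFactor q n τ ∣ momentFunctional
      (fun _ => newtonMoment q fun m => qPochPoly q m * C (c m)) (selbergPoly q n τ) := by
  rw [momentFunctional_newtonMoment hq0]
  refine Finset.dvd_sum fun m _ => ?_
  by_cases hm : newtonCoeffMulti q (selbergPoly q n τ) m = 0
  · rw [hm, zero_smul]; exact dvd_zero _
  obtain ⟨ν, hν, hne⟩ := exists_eval_ne_zero_of_newtonCoeffMulti hm
  simp only [← inv_pow] at hne
  obtain ⟨σ, hσ⟩ := exists_perm_of_separated (separated_of_eval_ne_zero hq0 (.inr rfl) hne)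
  refine dvd_smul_of_dvd _ ?_
  rw [lowerFactor, ← Equiv.prod_comp σ (fun i => qPochPoly q (m i) * C (c (m i)))]
  refine Finset.prod_dvd_prod_of_dvd _ _ fun j _ => Dvd.dvd.mul_right ?_ _
  refine Finset.prod_dvd_prod_of_subset _ _ _ (Finset.range_subset_range.mpr ?_)
  have := hσ j ⟨0, j.pos⟩ j (by simp)
  have := hν (σ j)
  omega

lemma natDegree_lowerFactor_le (q : ℝ) (n τ : ℕ) :
    (lowerFactor q n τ).natDegree ≤ halfDegree n τ :=
  natDegree_prod_le_sum _ _ _ fun j _ => natDegree_qPochPoly_le q (j * τ)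

/-- The leading coefficient of `lowerFactor`. -/
def lowerLead (q : ℝ) (n τ : ℕ) : ℂ := ∏ j : Fin n, qPochLead q (j * τ)

lemma coeff_lowerFactor (q : ℝ) (n τ : ℕ) :
    (lowerFactor q n τ).coeff (halfDegree n τ) = lowerLead q n τ := by
  rw [lowerFactor, halfDegree, coeff_prod_sum _ (fun j : Fin n => qPochPoly q (j * τ))
    (fun j : Fin n => (j : ℕ) * τ) fun j _ => natDegree_qPochPoly_le q (j * τ)]
  simp only [coeff_qPochPoly_self, lowerLead]

lemma lowerLead_ne_zero {q : ℝ} (hq0 : 0 < q) (n τ : ℕ) : lowerLead q n τ ≠ 0 :=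
  Finset.prod_ne_zero_iff.mpr fun _ _ => qPochLead_ne_zero hq0 _

lemma natDegree_lowerFactor {q : ℝ} (hq0 : 0 < q) (n τ : ℕ) :
    (lowerFactor q n τ).natDegree = halfDegree n τ :=
  natDegree_eq_of_le_of_coeff_ne_zero (natDegree_lowerFactor_le q n τ)
    (by rw [coeff_lowerFactor]; exact lowerLead_ne_zero hq0 n τ)

lemma lowerFactor_ne_zero {q : ℝ} (hq0 : 0 < q) (n τ : ℕ) : lowerFactor q n τ ≠ 0 :=
  Finset.prod_ne_zero_iff.mpr fun _ _ => qPochPoly_ne_zero hq0 _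

lemma eval_lowerFactor (q : ℝ) (n τ : ℕ) (x : ℂ) :
    (lowerFactor q n τ).eval x = ∏ j : Fin n, qPoch q x (j * τ) := by
  simp only [lowerFactor, eval_prod, eval_qPochPoly]

/-- The monic polynomial `X^h ∏_{0 ≤ j < n} (Y/X)_{jτ}`, with `h` its degree. -/
def upperFactor (q : ℝ) (n τ : ℕ) (Y : ℂ) : ℂ[X] :=
  ∏ j : Fin n, ∏ i ∈ Finset.range (j * τ), (X - C ((q : ℂ) ^ i * Y))

lemma monic_upperFactor (q : ℝ) (n τ : ℕ) (Y : ℂ) : (upperFactor q n τ Y).Monic :=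
  monic_prod_of_monic _ _ fun _ _ => monic_prod_of_monic _ _ fun _ _ => monic_X_sub_C _

lemma natDegree_upperFactor (q : ℝ) (n τ : ℕ) (Y : ℂ) :
    (upperFactor q n τ Y).natDegree = halfDegree n τ := by
  rw [upperFactor, natDegree_prod_of_monic _ _ fun _ _ =>
    monic_prod_of_monic _ _ fun _ _ => monic_X_sub_C _, halfDegree]
  refine Finset.sum_congr rfl fun j _ => ?_
  rw [natDegree_prod_of_monic _ _ fun _ _ => monic_X_sub_C _]
  simp only [natDegree_X_sub_C, Finset.sum_const, Finset.card_range, smul_eq_mul, mul_one]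

lemma eval_upperFactor (q : ℝ) (n τ : ℕ) (Y : ℂ) {x : ℂ} (hx : x ≠ 0) :
    (upperFactor q n τ Y).eval x = x ^ halfDegree n τ * ∏ j : Fin n, qPoch q (Y / x) (j * τ) := by
  rw [halfDegree, ← Finset.prod_pow_eq_pow_sum, ← Finset.prod_mul_distrib, upperFactor, eval_prod]
  refine Finset.prod_congr rfl fun j _ => ?_
  rw [eval_prod, qPoch]
  conv_rhs => rw [← Finset.card_range (j * τ : ℕ), ← Finset.prod_const,
    Finset.card_range, ← Finset.prod_mul_distrib]
  refine Finset.prod_congr rfl fun i _ => ?_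
  simp only [eval_sub, eval_X, eval_C]
  field_simp

lemma isCoprime_lowerFactor_upperFactor {q : ℝ} {n τ : ℕ} {Y : ℂ}
    (hY : ∀ m : ℕ, Y * (q : ℂ) ^ m ≠ 1) :
    IsCoprime (lowerFactor q n τ) (upperFactor q n τ Y) := by
  refine IsCoprime.prod_left fun j _ => IsCoprime.prod_left fun i _ =>
    IsCoprime.prod_right fun k _ => IsCoprime.prod_right fun l _ => ?_
  have hne : 1 - (q : ℂ) ^ i * ((q : ℂ) ^ l * Y) ≠ 0 := fun h =>
    hY (i + l) (by rw [pow_add]; linear_combination -h)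
  refine ⟨C (1 - (q : ℂ) ^ i * ((q : ℂ) ^ l * Y))⁻¹,
    C ((1 - (q : ℂ) ^ i * ((q : ℂ) ^ l * Y))⁻¹ * (q : ℂ) ^ i), ?_⟩
  have hu : C (1 - (q : ℂ) ^ i * ((q : ℂ) ^ l * Y))⁻¹ *
      (1 - C ((q : ℂ) ^ i) * C ((q : ℂ) ^ l * Y)) = 1 := by
    rw [← C_mul, ← C_1, ← C_sub, ← C_mul, inv_mul_cancel₀ hne]
  rw [C_mul]
  linear_combination hu

/-! ### The normalised Selberg sum -/

/-- The conditions under which `x = a₁ b₁` (or `a₂ b₁`) is allowed when `Y = a₁ a₂ b₁ b₂`. -/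
structure Generic (q : ℝ) (Y x : ℂ) : Prop where
  ne_zero : x ≠ 0
  lower : ∀ m : ℕ, x * (q : ℂ) ^ m ≠ 1
  upper : ∀ m : ℕ, Y / x * (q : ℂ) ^ m ≠ 1

lemma countable_not_generic {q : ℝ} (hq0 : 0 < q) (Y : ℂ) :
    {x : ℂ | ¬ Generic q Y x}.Countable := by
  have hq := ofReal_q_ne_zero hq0
  have : {x : ℂ | ¬ Generic q Y x} ⊆
      {0} ∪ (Set.range (fun m : ℕ => ((q : ℂ) ^ m)⁻¹) ∪
        Set.range fun m : ℕ => Y * (q : ℂ) ^ m) := by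
    intro x hx
    by_contra hcon
    simp only [Set.mem_union, Set.mem_singleton_iff, Set.mem_range, not_or, not_exists] at hcon
    obtain ⟨h0, h1, h2⟩ := hcon
    refine hx ⟨h0, fun m e => h1 m ?_, fun m e => h2 m ?_⟩
    · exact (eq_inv_of_mul_eq_one_left e).symm
    · rw [div_mul_eq_mul_div, div_eq_one_iff_eq h0] at e
      exact e
  exact ((Set.countable_singleton _).union
    ((Set.countable_range _).union (Set.countable_range _))).mono this

lemma infinite_of_countable_compl {s : Set ℂ} (h : sᶜ.Countable) : s.Infinite := by
  intro hs
  refine not_countable_complex ?_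
  rw [← Set.union_compl_self s]
  exact hs.countable.union h

/-- The moments with respect to `b₁` and with respect to `b₂` describe the same functional. -/
lemma newtonMoment_symm {q : ℝ} (hq0 : 0 < q) (hq1 : q < 1) {x y Y : ℂ} (hY0 : Y ≠ 0)
    (hY : ∀ m : ℕ, Y * (q : ℂ) ^ m ≠ 1) (hx : Generic q Y x) (hy : Generic q Y y)
    (hxy : ∀ m : ℕ, y * (q : ℂ) ^ m ≠ x) (hyx : ∀ m : ℕ, x * (q : ℂ) ^ m ≠ y) (d : ℕ) :
    (Y / (x * y)) ^ d * newtonMoment q (fun m => qPoch q x m * qPoch q y m / qPoch q Y m) d =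
      newtonMoment q (fun m => qPoch q (Y / y) m * qPoch q (Y / x) m / qPoch q Y m) d := by
  have hx0 := hx.ne_zero
  have hy0 := hy.ne_zero
  have hq := ofReal_q_ne_zero hq0
  have e1 : x * (Y / (x * y)) = Y / y := by field_simp
  have e2 : y * (Y / (x * y)) = Y / x := by field_simp
  have e5 : x * y * (Y / (x * y)) = Y := by field_simp
  have e3 : x * y * 1 * (Y / (x * y)) = Y := by field_simp
  have e4 : x * y * (Y / (x * y)) * 1 = Y := by field_simp
  have hadm : Admissible q x y 1 (Y / (x * y)) :=
    ⟨hx0, hy0, by simpa using hx.lower, by rw [e1]; exact hy.upper, by simpa using hy.lower,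
      by rw [e2]; exact hx.upper⟩
  have hJ : jacksonMoment q x y 1 (Y / (x * y)) 0 ≠ 0 := by
    intro h0
    have h1 := jacksonMoment_eq_base hq0 hq1 hadm
    rw [h0, mul_zero, e3, jacksonMoment_base hq0 hq1 hx0 hy0] at h1
    refine absurd h1.symm (mul_ne_zero (qPochInf_ne_zero hq0 hq1 hY) (mul_ne_zero ?_
      (mul_ne_zero (mul_ne_zero hy0 (qPochInf_q_ne_zero hq0 hq1)) (mul_ne_zero ?_ ?_))))
    · exact sub_ne_zero.mpr (by simpa using (q_pow_ne_one hq0 hq1 one_ne_zero).symm)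
    · refine qPochInf_ne_zero hq0 hq1 fun m e => hyx m ?_
      field_simp at e
      exact e
    · refine qPochInf_ne_zero hq0 hq1 fun m e => hxy (m + 1) ?_
      field_simp at e
      rw [pow_succ, ← e]; ring
  have m1 := jacksonMoment_eq_newtonMoment hq0 hq1 hadm (by rwa [e3]) d
  have m2 := jacksonMoment_eq_newtonMoment hq0 hq1 hadm.swap (by rwa [e4]) d
  simp only [e1, e2, e5, one_pow, one_mul, mul_one] at m1 m2
  rw [jacksonMoment_swap q x y (Y / (x * y)), jacksonMoment_swap q x y (Y / (x * y)), m1] at m2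
  refine mul_right_cancel₀ hJ ?_
  rw [← m2, mul_assoc]

/-- The `n`-fold integral divided by the `n`-th power of the total mass, up to a power of `b₁`,
in terms of `x = a₁ b₁`, `y = a₂ b₁` and `Y = a₁ a₂ b₁ b₂`. -/
def selbergSum (q : ℝ) (n τ : ℕ) (x y Y : ℂ) : ℂ :=
  momentFunctional (fun _ => newtonMoment q fun m => qPoch q x m * qPoch q y m / qPoch q Y m)
    (selbergPoly q n τ)

lemma selbergSum_comm (q : ℝ) (n τ : ℕ) (x y Y : ℂ) :
    selbergSum q n τ x y Y = selbergSum q n τ y x Y := by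
  simp only [selbergSum, mul_comm (qPoch q x _)]

lemma selbergSum_symm {q : ℝ} (hq0 : 0 < q) (hq1 : q < 1) (n τ : ℕ) {x y Y : ℂ} (hY0 : Y ≠ 0)
    (hY : ∀ m : ℕ, Y * (q : ℂ) ^ m ≠ 1) (hx : Generic q Y x) (hy : Generic q Y y)
    (hxy : ∀ m : ℕ, y * (q : ℂ) ^ m ≠ x) (hyx : ∀ m : ℕ, x * (q : ℂ) ^ m ≠ y) :
    (Y / (x * y)) ^ (halfDegree n τ * 2) * selbergSum q n τ x y Y =
      selbergSum q n τ (Y / y) (Y / x) Y := by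
  rw [selbergSum, ← momentFunctional_mul_pow (isHomogeneous_selbergPoly q n τ)]
  simp only [newtonMoment_symm hq0 hq1 hY0 hY hx hy hxy hyx]
  rfl

/-- `selbergSum`, as a polynomial in its first variable. -/
def selbergSumPoly (q : ℝ) (n τ : ℕ) (y Y : ℂ) : ℂ[X] :=
  momentFunctional (fun _ => newtonMoment q fun m => qPochPoly q m * C (qPoch q y m / qPoch q Y m))
    (selbergPoly q n τ)

lemma eval_selbergSumPoly (q : ℝ) (n τ : ℕ) (x y Y : ℂ) :
    (selbergSumPoly q n τ y Y).eval x = selbergSum q n τ x y Y := by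
  rw [← coe_aeval_eq_eval, selbergSumPoly, map_momentFunctional]
  simp only [map_newtonMoment, coe_aeval_eq_eval, eval_mul, eval_C, eval_qPochPoly, selbergSum,
    mul_div_assoc]

lemma natDegree_selbergSumPoly_le (q : ℝ) (n τ : ℕ) (y Y : ℂ) :
    (selbergSumPoly q n τ y Y).natDegree ≤ halfDegree n τ * 2 :=
  natDegree_momentFunctional_le (isHomogeneous_selbergPoly q n τ) _ fun _ d =>
    natDegree_newtonMoment_le q _ d

/-- The top coefficient of `selbergSum` in its first variable. -/
def selbergTop (q : ℝ) (n τ : ℕ) (y Y : ℂ) : ℂ :=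
  momentFunctional (fun _ d => qPoch q y d / qPoch q Y d) (selbergPoly q n τ)

lemma coeff_selbergSumPoly {q : ℝ} (hq0 : 0 < q) (hq1 : q < 1) (n τ : ℕ) (y Y : ℂ) :
    (selbergSumPoly q n τ y Y).coeff (halfDegree n τ * 2) = selbergTop q n τ y Y := by
  rw [selbergSumPoly, coeff_momentFunctional (isHomogeneous_selbergPoly q n τ) _ fun _ d =>
    natDegree_newtonMoment_le q _ d]
  simp only [coeff_newtonMoment hq0 hq1, selbergTop]

lemma exists_selbergTop_poly (q : ℝ) (n τ : ℕ) (Y : ℂ) :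
    ∃ p : ℂ[X], ∀ y, p.eval y = selbergTop q n τ y Y := by
  refine ⟨momentFunctional (fun _ d => qPochPoly q d * C (qPoch q Y d)⁻¹) (selbergPoly q n τ),
    fun y => ?_⟩
  rw [← coe_aeval_eq_eval, map_momentFunctional]
  simp only [coe_aeval_eq_eval, eval_mul, eval_C, eval_qPochPoly, selbergTop, div_eq_mul_inv]

/-- `x ^ h * H(Y / x)` is a polynomial in `x` when `deg H ≤ h`. -/
lemma exists_reverse_eval (Y : ℂ) {H : ℂ[X]} {h : ℕ} (hH : H.natDegree ≤ h) :
    ∃ K : ℂ[X], ∀ x : ℂ, x ≠ 0 → x ^ h * H.eval (Y / x) = K.eval x := by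
  refine ⟨∑ i ∈ Finset.range (h + 1), C (H.coeff i * Y ^ i) * X ^ (h - i), fun x hx => ?_⟩
  rw [eval_eq_sum_range' (Nat.lt_succ_of_le hH), Finset.mul_sum, eval_finsetSum]
  refine Finset.sum_congr rfl fun i hi => ?_
  have : x ^ h = x ^ (h - i) * x ^ i := by
    rw [← pow_add, Nat.sub_add_cancel (Nat.lt_succ_iff.mp (Finset.mem_range.mp hi))]
  simp only [eval_mul, eval_C, eval_pow, eval_X]
  rw [this, div_pow]
  field_simp

/-- The zeros in `x = a₁ b₁` coming from the Newton expansion in `b₁`, and those coming from the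
expansion in `b₂`, exhaust the degree. -/
lemma exists_selbergSumPoly_eq {q : ℝ} (hq0 : 0 < q) (hq1 : q < 1) (n τ : ℕ) {y Y : ℂ}
    (hY0 : Y ≠ 0) (hY : ∀ m : ℕ, Y * (q : ℂ) ^ m ≠ 1) (hy : Generic q Y y) :
    ∃ c : ℂ, selbergSumPoly q n τ y Y = C c * (lowerFactor q n τ * upperFactor q n τ Y) := by
  set h := halfDegree n τ with hh
  have hZ0 := lowerFactor_ne_zero hq0 n τ
  have hU0 := (monic_upperFactor q n τ Y).ne_zero
  have hlow : lowerFactor q n τ ∣ selbergSumPoly q n τ y Y := lowerFactor_dvd hq0 n τ _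
  -- `Y^(2h) F(x, y) = (x y)^(2h) F(Y/x, Y/y)`, and `F(·, Y/y)` has the lower factor too
  have hup : upperFactor q n τ Y ∣ selbergSumPoly q n τ y Y := by
    obtain ⟨H, hH⟩ : lowerFactor q n τ ∣ selbergSumPoly q n τ (Y / y) Y := lowerFactor_dvd hq0 n τ _
    have hHdeg : H.natDegree ≤ h := by
      by_cases hH0 : H = 0
      · simp [hH0]
      · have := natDegree_selbergSumPoly_le q n τ (Y / y) Y
        rw [hH, natDegree_mul hZ0 hH0, natDegree_lowerFactor hq0] at this
        omega
    obtain ⟨K, hK⟩ := exists_reverse_eval Y hHdeg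
    have hpoly : C (Y ^ (h * 2)) * selbergSumPoly q n τ y Y =
        C (y ^ (h * 2)) * (upperFactor q n τ Y * K) := by
      -- the symmetry holds off a countable set of `x`, which suffices for polynomials
      have hinf : {x : ℂ | Generic q Y x ∧ (∀ m : ℕ, y * (q : ℂ) ^ m ≠ x) ∧
          ∀ m : ℕ, x * (q : ℂ) ^ m ≠ y}.Infinite := by
        refine infinite_of_countable_compl (((countable_not_generic hq0 Y).union
          ((Set.countable_range fun m : ℕ => y * (q : ℂ) ^ m).union
            (Set.countable_range fun m : ℕ => y / (q : ℂ) ^ m))).mono fun x hx => ?_)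
        by_contra hcon
        simp only [Set.mem_union, Set.mem_ofPred_eq, not_or, not_not, Set.mem_range,
          not_exists] at hcon
        refine hx ⟨hcon.1, hcon.2.1, fun m e => hcon.2.2 m ?_⟩
        rw [← e, mul_div_cancel_right₀ _ (pow_ne_zero m (ofReal_q_ne_zero hq0))]
      refine eq_of_infinite_eval_eq _ _ (hinf.mono ?_)
      rintro x ⟨hx, hxy, hyx⟩
      have hx0 := hx.ne_zero
      have hy0 := hy.ne_zero
      have e1 := selbergSum_symm hq0 hq1 n τ hY0 hY hx hy hxy hyx
      rw [selbergSum_comm q n τ (Y / y), ← eval_selbergSumPoly q n τ (Y / x), hH, eval_mul,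
        eval_lowerFactor, ← eval_selbergSumPoly, ← hh] at e1
      simp only [Set.mem_ofPred_eq, eval_mul, eval_C]
      rw [eval_upperFactor q n τ Y hx0, ← hK x hx0, ← hh]
      rw [div_pow, mul_pow, div_mul_eq_mul_div, div_eq_iff (by positivity)] at e1
      rw [e1]
      ring
    have hu : C (Y ^ (h * 2))⁻¹ * C (Y ^ (h * 2)) = 1 := by
      rw [← C_mul, inv_mul_cancel₀ (pow_ne_zero _ hY0), C_1]
    refine ⟨C (Y ^ (h * 2))⁻¹ * C (y ^ (h * 2)) * K, ?_⟩
    linear_combination C (Y ^ (h * 2))⁻¹ * hpoly - selbergSumPoly q n τ y Y * hu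
  obtain ⟨R, hR⟩ := (isCoprime_lowerFactor_upperFactor (n := n) (τ := τ) hY).mul_dvd hlow hup
  have hRdeg : R.natDegree = 0 := by
    by_cases hR0 : R = 0
    · simp [hR0]
    · have := natDegree_selbergSumPoly_le q n τ y Y
      rw [hR, natDegree_mul (mul_ne_zero hZ0 hU0) hR0, natDegree_mul hZ0 hU0,
        natDegree_lowerFactor hq0, natDegree_upperFactor] at this
      omega
  refine ⟨R.coeff 0, ?_⟩
  rw [← eq_C_of_natDegree_eq_zero hRdeg, hR, mul_comm]

lemma lowerLead_mul_selbergSum {q : ℝ} (hq0 : 0 < q) (hq1 : q < 1) (n τ : ℕ) {y Y : ℂ}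
    (hY0 : Y ≠ 0) (hY : ∀ m : ℕ, Y * (q : ℂ) ^ m ≠ 1) (hy : Generic q Y y) (x : ℂ) :
    lowerLead q n τ * selbergSum q n τ x y Y =
      selbergTop q n τ y Y * (lowerFactor q n τ * upperFactor q n τ Y).eval x := by
  obtain ⟨c, hc⟩ := exists_selbergSumPoly_eq hq0 hq1 n τ hY0 hY hy
  have h1 : c * lowerLead q n τ = selbergTop q n τ y Y := by
    have hU : (upperFactor q n τ Y).coeff (halfDegree n τ) = 1 := by
      rw [← natDegree_upperFactor q n τ Y]; exact monic_upperFactor q n τ Y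
    rw [← coeff_selbergSumPoly hq0 hq1, hc, coeff_C_mul, mul_two,
      coeff_mul_add_eq_of_natDegree_le (natDegree_lowerFactor_le q n τ)
        (natDegree_upperFactor q n τ Y).le, coeff_lowerFactor, hU, mul_one]
  rw [← eval_selbergSumPoly, hc, eval_mul, eval_C, ← h1]
  ring

/-- By the symmetry of `selbergSum` in `x` and `y`, the top coefficient is, as a function of `y`,
a multiple of the same polynomial. -/
lemma selbergTop_mul {q : ℝ} (hq0 : 0 < q) (hq1 : q < 1) (n τ : ℕ) {y Y : ℂ}
    (hY0 : Y ≠ 0) (hY : ∀ m : ℕ, Y * (q : ℂ) ^ m ≠ 1) (hy : Generic q Y y) (y₁ : ℂ) :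
    selbergTop q n τ y₁ Y * (lowerFactor q n τ * upperFactor q n τ Y).eval y =
      selbergTop q n τ y Y * (lowerFactor q n τ * upperFactor q n τ Y).eval y₁ := by
  obtain ⟨p, hp⟩ := exists_selbergTop_poly q n τ Y
  have hfac := fun y (hy : Generic q Y y) x => lowerLead_mul_selbergSum hq0 hq1 n τ hY0 hY hy x
  generalize lowerFactor q n τ * upperFactor q n τ Y = V at *
  have hpoly : p * C (V.eval y) = C (selbergTop q n τ y Y) * V := by
    have hinf : {x : ℂ | Generic q Y x}.Infinite :=
      infinite_of_countable_compl (countable_not_generic hq0 Y)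
    refine eq_of_infinite_eval_eq _ _ (hinf.mono fun x hx => ?_)
    have e1 := hfac x hx y
    rw [selbergSum_comm, hfac y hy x] at e1
    show (p * C _).eval x = (C _ * _).eval x
    rw [eval_mul, eval_C, hp, eval_mul, eval_C, e1]
  have := congrArg (Polynomial.eval y₁) hpoly
  rwa [eval_mul, eval_C, hp, eval_mul, eval_C] at this

/-! ### The normalising constant -/

lemma prod_range_mul_eq (f : ℕ → ℂ) (n τ : ℕ) :
    ∏ l ∈ Finset.range (n * τ), f l =
      ∏ i ∈ Finset.range n, ∏ s ∈ Finset.range τ, f (i * τ + s) := by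
  induction n with
  | zero => simp
  | succ n ih => rw [Nat.succ_mul, Finset.prod_range_add, Finset.prod_range_succ, ih]

lemma prod_q_pow_sub (q : ℝ) (N : ℕ) :
    ∏ l ∈ Finset.range N, ((q : ℂ) ^ N - (q : ℂ) ^ l) = qPochLead q N * qPoch q (q : ℂ) N := by
  rw [qPoch, ← Finset.prod_range_reflect (fun i => 1 - (q : ℂ) ^ i * q), qPochLead,
    ← Finset.prod_mul_distrib]
  refine Finset.prod_congr rfl fun l hl => ?_
  have hl := Finset.mem_range.mp hl
  have : (q : ℂ) ^ N = (q : ℂ) ^ l * ((q : ℂ) ^ (N - 1 - l) * q) := by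
    rw [← pow_succ, ← pow_add]; congr 1; omega
  rw [this]; ring

/-- The `q`-discriminant of the geometric progression `1, t, …, t^(n-1)` with `t = q^τ`. -/
lemma prod_geometric_progression (q : ℝ) (n τ : ℕ) :
    ∏ j ∈ Finset.range n, ∏ k ∈ Finset.range n, (if k = j then 1 else
        ∏ s ∈ Finset.range τ, ((q : ℂ) ^ (j * τ) - (q : ℂ) ^ s * (q : ℂ) ^ (k * τ))) =
      ∏ j ∈ Finset.range n, (qPochLead q (j * τ) * qPoch q (q : ℂ) (j * τ) *
        qPoch q ((q : ℂ) ^ τ) (j * τ) * ((q : ℂ) ^ (j * τ)) ^ ((n - 1 - j) * τ)) := by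
  induction n with
  | zero => simp
  | succ n ih =>
    rw [Finset.prod_range_succ]
    conv_lhs => enter [1, 2, j]; rw [Finset.prod_range_succ]
    rw [Finset.prod_mul_distrib, ih, Finset.prod_range_succ (n := n), if_pos rfl, mul_one]
    have hg1 : ∏ k ∈ Finset.range n, (if k = n then 1 else
        ∏ s ∈ Finset.range τ, ((q : ℂ) ^ (n * τ) - (q : ℂ) ^ s * (q : ℂ) ^ (k * τ))) =
        qPochLead q (n * τ) * qPoch q (q : ℂ) (n * τ) := by
      rw [← prod_q_pow_sub, prod_range_mul_eq]
      refine Finset.prod_congr rfl fun k hk => ?_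
      rw [if_neg (Finset.mem_range.mp hk).ne]
      refine Finset.prod_congr rfl fun s _ => ?_
      rw [← pow_add, add_comm s]
    have hg2 : ∏ j ∈ Finset.range n, (if n = j then 1 else
        ∏ s ∈ Finset.range τ, ((q : ℂ) ^ (j * τ) - (q : ℂ) ^ s * (q : ℂ) ^ (n * τ))) =
        (∏ j ∈ Finset.range n, ((q : ℂ) ^ (j * τ)) ^ τ) * qPoch q ((q : ℂ) ^ τ) (n * τ) := by
      rw [qPoch, prod_range_mul_eq, ← Finset.prod_range_reflect (fun i =>
        ∏ s ∈ Finset.range τ, (1 - (q : ℂ) ^ (i * τ + s) * (q : ℂ) ^ τ)),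
        ← Finset.prod_mul_distrib]
      refine Finset.prod_congr rfl fun j hj => ?_
      have hj := Finset.mem_range.mp hj
      rw [if_neg hj.ne']
      conv_rhs => rw [← Finset.card_range τ, ← Finset.prod_const, Finset.card_range,
        ← Finset.prod_mul_distrib]
      refine Finset.prod_congr rfl fun s _ => ?_
      have : (q : ℂ) ^ (n * τ) =
          (q : ℂ) ^ (j * τ) * ((q : ℂ) ^ ((n - 1 - j) * τ) * (q : ℂ) ^ τ) := by
        rw [← pow_add, ← pow_add]
        congr 1
        obtain ⟨r, rfl⟩ : ∃ r, n = j + 1 + r := ⟨n - (j + 1), by omega⟩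
        have : j + 1 + r - 1 - j = r := by omega
        rw [this]; ring
      rw [this, pow_add]
      ring
    rw [hg1, hg2, Finset.prod_range_succ]
    have hstep : ∏ j ∈ Finset.range n, (qPochLead q (j * τ) * qPoch q (q : ℂ) (j * τ) *
        qPoch q ((q : ℂ) ^ τ) (j * τ) * ((q : ℂ) ^ (j * τ)) ^ ((n + 1 - 1 - j) * τ)) =
        (∏ j ∈ Finset.range n, (qPochLead q (j * τ) * qPoch q (q : ℂ) (j * τ) *
        qPoch q ((q : ℂ) ^ τ) (j * τ) * ((q : ℂ) ^ (j * τ)) ^ ((n - 1 - j) * τ))) *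
        ∏ j ∈ Finset.range n, ((q : ℂ) ^ (j * τ)) ^ τ := by
      rw [← Finset.prod_mul_distrib]
      refine Finset.prod_congr rfl fun j hj => ?_
      have hj := Finset.mem_range.mp hj
      have : (n + 1 - 1 - j) * τ = (n - 1 - j) * τ + τ := by
        rw [← Nat.succ_mul]; congr 1; omega
      rw [this, pow_add]
      ring
    rw [hstep]
    have h0 : (n + 1 - 1 - n) * τ = 0 := by simp
    rw [h0, pow_zero]
    ring

lemma eval_selbergPoly_geometric (q : ℝ) (n τ : ℕ) :
    MvPolynomial.eval (fun i : Fin n => (q : ℂ) ^ ((i : ℕ) * τ)) (selbergPoly q n τ) =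
      ∏ j : Fin n, (qPochLead q (j * τ) * qPoch q (q : ℂ) (j * τ) *
        qPoch q ((q : ℂ) ^ τ) (j * τ) * ((q : ℂ) ^ ((j : ℕ) * τ)) ^ ((n - 1 - j) * τ)) := by
  rw [Fin.prod_univ_eq_prod_range (fun j => qPochLead q (j * τ) * qPoch q (q : ℂ) (j * τ) *
        qPoch q ((q : ℂ) ^ τ) (j * τ) * ((q : ℂ) ^ (j * τ)) ^ ((n - 1 - j) * τ)),
    ← prod_geometric_progression, eval_selbergPoly, Finset.prod_range]
  refine Finset.prod_congr rfl fun j _ => ?_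
  rw [Finset.prod_range, ← Finset.prod_compl_mul_prod {j}, Finset.prod_singleton, if_pos rfl,
    mul_one]
  refine Finset.prod_congr rfl fun k hk => ?_
  rw [if_neg]
  simpa [Fin.ext_iff] using hk

/-- At `y = Y q^((n-1)τ)` the functional is supported on `1, q, …, q^((n-1)τ)`, so only the
rearrangements of `1, t, …, t^(n-1)` contribute. -/
lemma selbergTop_special {q : ℝ} (hq0 : 0 < q) (n τ : ℕ) (hτ : 0 < τ) {Y : ℂ}
    (hY : ∀ m : ℕ, Y * (q : ℂ) ^ m ≠ 1) :
    selbergTop q n τ ((q : ℂ) ^ ((n - 1) * τ) * Y) Y =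
      (n.factorial : ℂ) *
        ((∏ j : Fin n, ((qPochPoly q ((n - 1) * τ)).coeff (j * τ) * Y ^ ((j : ℕ) * τ) /
        qPoch q Y ((n - 1) * τ))) *
        MvPolynomial.eval (fun i : Fin n => (q : ℂ) ^ ((i : ℕ) * τ)) (selbergPoly q n τ)) := by
  set k := (n - 1) * τ with hk
  have hYn : ∀ N, qPoch q Y N ≠ 0 := fun N => qPoch_ne_zero fun m _ => hY m
  -- `(Y q^k)_d / (Y)_d = (Y q^d)_k / (Y)_k` is a polynomial in `q^d`
  have hmom : ∀ d : ℕ, qPoch q ((q : ℂ) ^ k * Y) d / qPoch q Y d =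
      ∑ ν ∈ Finset.range (k + 1),
        ((qPochPoly q k).coeff ν * Y ^ ν / qPoch q Y k) * ((q : ℂ) ^ ν) ^ d := by
    intro d
    have e1 := qPoch_add q Y k d
    rw [add_comm, qPoch_add, ← eval_qPochPoly q k, eval_eq_sum_range'
      (Nat.lt_succ_of_le (natDegree_qPochPoly_le q k))] at e1
    rw [div_eq_iff (hYn d), ← mul_right_inj' (hYn k), ← e1, Finset.mul_sum, Finset.sum_mul,
      Finset.mul_sum]
    refine Finset.sum_congr rfl fun ν _ => ?_
    have := hYn k
    rw [mul_pow, ← pow_mul, ← pow_mul, mul_comm d ν]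
    field_simp
  rw [selbergTop]
  simp only [hmom]
  rw [momentFunctional_eq_sum_eval (fun _ => Finset.range (k + 1))
    (fun _ ν => (qPochPoly q k).coeff ν * Y ^ ν / qPoch q Y k) (fun _ ν => (q : ℂ) ^ ν)]
  set emb : Equiv.Perm (Fin n) → (Fin n → ℕ) := fun σ i => (σ i : ℕ) * τ with hemb
  have hinj : Function.Injective emb := fun σ σ' h => by
    ext i
    exact Nat.eq_of_mul_eq_mul_right hτ (congrFun h i)
  have hsub : Finset.univ.image emb ⊆ Fintype.piFinset fun _ : Fin n => Finset.range (k + 1) := by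
    intro ν hν
    obtain ⟨σ, -, rfl⟩ := Finset.mem_image.mp hν
    refine Fintype.mem_piFinset.mpr fun i => Finset.mem_range.mpr (Nat.lt_succ_of_le ?_)
    exact Nat.mul_le_mul_right τ (by omega)
  rw [← Finset.sum_subset hsub, Finset.sum_image fun _ _ _ _ h => hinj h]
  · rw [Finset.sum_congr rfl (g := fun _ => (∏ j : Fin n, ((qPochPoly q k).coeff (j * τ) *
      Y ^ ((j : ℕ) * τ) / qPoch q Y k)) *
        MvPolynomial.eval (fun i : Fin n => (q : ℂ) ^ ((i : ℕ) * τ)) (selbergPoly q n τ))]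
    · rw [Finset.sum_const, Finset.card_univ, Fintype.card_perm, Fintype.card_fin, nsmul_eq_mul]
    · intro σ _
      rw [← eval_selbergPoly_perm q n τ (fun i : Fin n => (q : ℂ) ^ ((i : ℕ) * τ)) σ,
        ← Equiv.prod_comp σ (fun j : Fin n =>
        (qPochPoly q k).coeff (j * τ) * Y ^ ((j : ℕ) * τ) / qPoch q Y k)]
  · intro ν hν hnot
    by_contra hne
    have hne := right_ne_zero_of_mul hne
    obtain ⟨σ, hσ⟩ := exists_perm_of_separated (separated_of_eval_ne_zero hq0 (.inl rfl) hne)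
    refine hnot (Finset.mem_image.mpr ⟨σ.symm, Finset.mem_univ _, funext fun i => ?_⟩)
    obtain ⟨j, rfl⟩ := σ.surjective i
    have hj := j.isLt
    have h1 := hσ j ⟨0, by omega⟩ j (by simp)
    have h2 := hσ (n - 1 - j) j ⟨n - 1, by omega⟩ (by simp only; omega)
    have h3 := Finset.mem_range.mp (Fintype.mem_piFinset.mp hν (σ ⟨n - 1, by omega⟩))
    have h4 : k = (n - 1 - j) * τ + j * τ := by
      rw [hk, ← add_mul]; congr 1; omega
    simp only [hemb, Equiv.symm_apply_apply]
    omega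

/-- The closed form of the normalised Selberg sum. -/
theorem selbergSum_eq {q : ℝ} (hq0 : 0 < q) (hq1 : q < 1) (n τ : ℕ) (hτ : 0 < τ) {x y Y : ℂ}
    (hY0 : Y ≠ 0) (hY : ∀ m : ℕ, Y * (q : ℂ) ^ m ≠ 1) (hy : Generic q Y y) :
    selbergSum q n τ x y Y * ∏ j : Fin n, qPoch q Y ((n - 1) * τ + j * τ) =
      (n.factorial : ℂ) * (∏ j : Fin n, qPoch q ((q : ℂ) ^ τ) (j * τ) *
        ((q : ℂ) ^ ((j : ℕ) * τ)) ^ ((n - 1 - j) * τ)) *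
        ((lowerFactor q n τ * upperFactor q n τ Y).eval x *
          (lowerFactor q n τ * upperFactor q n τ Y).eval y) := by
  have hq := ofReal_q_ne_zero hq0
  set k := (n - 1) * τ with hk
  set y₁ := (q : ℂ) ^ k * Y with hy₁
  have hYn : ∀ N, qPoch q Y N ≠ 0 := fun N => qPoch_ne_zero fun m _ => hY m
  have hlow : (lowerFactor q n τ).eval y₁ * ∏ _j : Fin n, qPoch q Y k =
      ∏ j : Fin n, qPoch q Y (k + j * τ) := by
    rw [eval_lowerFactor, ← Finset.prod_mul_distrib]
    refine Finset.prod_congr rfl fun j _ => ?_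
    rw [qPoch_add, mul_comm]
  have hup : (upperFactor q n τ Y).eval y₁ = ∏ j : Fin n, ((qPochPoly q k).coeff (j * τ) *
      Y ^ ((j : ℕ) * τ) * qPoch q (q : ℂ) (j * τ)) := by
    rw [upperFactor, eval_prod]
    refine Finset.prod_congr rfl fun j _ => ?_
    rw [mul_right_comm, coeff_qPochPoly_mul, eval_prod]
    conv_rhs => rw [← Finset.card_range (j * τ : ℕ), ← Finset.prod_const, Finset.card_range,
      ← Finset.prod_mul_distrib]
    refine Finset.prod_congr rfl fun i _ => ?_
    simp only [eval_sub, eval_X, eval_C, hy₁]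
    ring
  have hn : (lowerFactor q n τ * upperFactor q n τ Y).eval y₁ ≠ 0 := by
    rw [eval_mul]
    refine mul_ne_zero (left_ne_zero_of_mul (b := ∏ _j : Fin n, qPoch q Y k) ?_) ?_
    · rw [hlow]; exact Finset.prod_ne_zero_iff.mpr fun _ _ => hYn _
    · rw [upperFactor, eval_prod]
      refine Finset.prod_ne_zero_iff.mpr fun j _ => ?_
      rw [eval_prod]
      refine Finset.prod_ne_zero_iff.mpr fun i hi => ?_
      simp only [eval_sub, eval_X, eval_C, hy₁]
      intro h0
      have := q_pow_injective hq0 hq1 (mul_right_cancel₀ hY0 (sub_eq_zero.mp h0))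
      have h1 := Finset.mem_range.mp hi
      have h2 : (j : ℕ) * τ ≤ k := Nat.mul_le_mul_right τ (by omega)
      omega
  have htop : selbergTop q n τ y₁ Y * ∏ j : Fin n, qPoch q Y (k + j * τ) =
      lowerLead q n τ * ((n.factorial : ℂ) * (∏ j : Fin n, qPoch q ((q : ℂ) ^ τ) (j * τ) *
        ((q : ℂ) ^ ((j : ℕ) * τ)) ^ ((n - 1 - j) * τ))) *
        (lowerFactor q n τ * upperFactor q n τ Y).eval y₁ := by
    rw [hy₁, hk, selbergTop_special hq0 n τ hτ hY, ← hk, ← hy₁, ← hlow, eval_mul, hup,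
      eval_selbergPoly_geometric, lowerLead]
    have hw : (∏ j : Fin n, ((qPochPoly q k).coeff (j * τ) * Y ^ ((j : ℕ) * τ) / qPoch q Y k)) *
        ∏ _j : Fin n, qPoch q Y k = ∏ j : Fin n, ((qPochPoly q k).coeff (j * τ) *
          Y ^ ((j : ℕ) * τ)) := by
      rw [← Finset.prod_mul_distrib]
      exact Finset.prod_congr rfl fun j _ => div_mul_cancel₀ _ (hYn k)
    simp only [Finset.prod_mul_distrib] at hw ⊢
    linear_combination (n.factorial : ℂ) * (lowerFactor q n τ).eval y₁ *
      ((∏ j : Fin n, qPochLead q (j * τ)) * (∏ j : Fin n, qPoch q (q : ℂ) (j * τ)) *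
        (∏ j : Fin n, qPoch q ((q : ℂ) ^ τ) (j * τ)) *
        ∏ j : Fin n, ((q : ℂ) ^ ((j : ℕ) * τ)) ^ ((n - 1 - j) * τ)) * hw
  have e1 := lowerLead_mul_selbergSum hq0 hq1 n τ hY0 hY hy x
  have e2 := selbergTop_mul hq0 hq1 n τ hY0 hY hy y₁
  refine mul_left_cancel₀ (mul_ne_zero (lowerLead_ne_zero hq0 n τ) hn) ?_
  generalize (lowerFactor q n τ * upperFactor q n τ Y).eval y₁ = V at *
  generalize (lowerFactor q n τ * upperFactor q n τ Y).eval x = Vx at *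
  generalize (lowerFactor q n τ * upperFactor q n τ Y).eval y = Vy at *
  generalize (∏ j : Fin n, qPoch q Y (k + j * τ)) = W at *
  linear_combination V * W * e1 - Vx * W * e2 + Vx * Vy * htop

/-! ### Iterated Jackson integrals of sums of products -/

lemma iteratedJackson_congr {q : ℝ} (hq0 : 0 < q) {a b : ℂ} (ha : a ≠ 0) (hb : b ≠ 0) {n : ℕ}
    {f g : (Fin n → ℂ) → ℂ} (h : ∀ z : Fin n → ℂ, (∀ i, z i ≠ 0) → f z = g z) :
    iteratedJackson q a b n f = iteratedJackson q a b n g := by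
  induction n with
  | zero => exact h _ fun i => i.elim0
  | succ n ih =>
    refine jackson_congr hq0 ha hb fun z hz => ih fun w hw => h _ fun i => ?_
    refine Fin.cases ?_ (fun i => ?_) i
    · simpa using hz
    · simpa using hw i

lemma iteratedJackson_sum_prod {ι : Type*} {q : ℝ} {a b : ℂ} {n : ℕ} (s : Finset ι) (c : ι → ℂ)
    (g : ι → Fin n → ℂ → ℂ) (hg : ∀ r i, JacksonSummable q a b (g r i)) :
    iteratedJackson q a b n (fun z => ∑ r ∈ s, c r * ∏ i, g r i (z i)) =
      ∑ r ∈ s, c r * ∏ i, jackson q a b (g r i) := by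
  induction n generalizing c with
  | zero => simp [iteratedJackson]
  | succ n ih =>
    have h1 : ∀ z : ℂ, iteratedJackson q a b n (fun w => ∑ r ∈ s, c r *
        ∏ i, g r i ((Fin.cons z w : Fin (n + 1) → ℂ) i)) =
        ∑ r ∈ s, (c r * ∏ i : Fin n, jackson q a b (g r i.succ)) * g r 0 z := by
      intro z
      have := ih (fun r => c r * g r 0 z) (fun r i => g r i.succ) fun r i => hg r i.succ
      simp only [Fin.prod_univ_succ, Fin.cons_zero, Fin.cons_succ, ← mul_assoc]
      rw [this]
      exact Finset.sum_congr rfl fun r _ => by ring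
    simp only [iteratedJackson, h1]
    rw [jackson_sum _ _ _ fun r _ => hg r 0]
    refine Finset.sum_congr rfl fun r _ => ?_
    rw [Fin.prod_univ_succ]
    ring

lemma summable_prod_pi {n : ℕ} (F : Fin n → ℕ → ℝ) (h0 : ∀ i ν, 0 ≤ F i ν)
    (hF : ∀ i, Summable (F i)) : Summable fun ν : Fin n → ℕ => ∏ i, F i (ν i) := by
  induction n with
  | zero => exact Summable.of_finite
  | succ n ih =>
    rw [← (Fin.consEquiv fun _ : Fin (n + 1) => ℕ).summable_iff]
    have := Summable.mul_of_nonneg (hF 0)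
      (ih (fun i => F i.succ) (fun i => h0 i.succ) fun i => hF i.succ) (h0 0)
      (fun ν => Finset.prod_nonneg fun i _ => h0 i.succ (ν i))
    refine this.congr fun p => ?_
    simp [Fin.prod_univ_succ, Fin.consEquiv]

lemma jacksonConverges_sum_prod {ι : Type*} {q : ℝ} {a b : ℂ} {n : ℕ} (s : Finset ι) (c : ι → ℂ)
    (g : ι → Fin n → ℂ → ℂ) (hg : ∀ r i, JacksonSummable q a b (g r i)) :
    JacksonConverges q a b n (fun z => ∑ r ∈ s, c r * ∏ i, g r i (z i)) := by
  intro e he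
  have h1 : ∀ r ∈ s, Summable fun ν : Fin n → ℕ => ‖c r‖ *
      ∏ i, ‖g r i (e i * (q : ℂ) ^ ν i) * (e i * (q : ℂ) ^ ν i)‖ := fun r _ =>
    (summable_prod_pi (fun i ν => ‖g r i (e i * (q : ℂ) ^ ν) * (e i * (q : ℂ) ^ ν)‖)
      (fun _ _ => norm_nonneg _) fun i => hg r i (e i) (he i)).mul_left _
  refine .of_nonneg_of_le (fun _ => norm_nonneg _) (fun ν => ?_) (summable_sum h1)
  rw [Finset.sum_mul]
  refine (norm_sum_le _ _).trans (Finset.sum_le_sum fun r _ => ?_)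
  rw [mul_assoc, ← Finset.prod_mul_distrib, norm_mul, norm_prod]

lemma JacksonConverges.congr {q : ℝ} (hq0 : 0 < q) {a b : ℂ} (ha : a ≠ 0) (hb : b ≠ 0) {n : ℕ}
    {f g : (Fin n → ℂ) → ℂ} (h : ∀ z : Fin n → ℂ, (∀ i, z i ≠ 0) → f z = g z)
    (hf : JacksonConverges q a b n f) : JacksonConverges q a b n g := by
  intro e he
  refine (hf e he).congr fun ν => ?_
  rw [h _ fun i => mul_ne_zero ?_ (pow_ne_zero _ (ofReal_q_ne_zero hq0))]
  rcases he i with h | h <;> rw [h] <;> assumption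

/-! ### The `q`-Selberg integral -/

lemma integrand_eq {q : ℝ} {n τ : ℕ} (a₁ a₂ b₁ b₂ : ℂ) {z : Fin n → ℂ} (hz : ∀ i, z i ≠ 0) :
    integrand q n τ a₁ a₂ b₁ b₂ z =
      ∑ d ∈ (selbergPoly q n τ).support, (selbergPoly q n τ).coeff d *
        ∏ i, (weight q a₁ a₂ b₁ b₂ (z i) * z i ^ d i) := by
  have h1 := Finset.prod_prod_Ioi_mul_eq_prod_prod_off_diag
    fun j i : Fin n => qPoch q (z j / z i) τ
  have h2 : (∏ i, z i ^ ((n - 1) * τ)) * ∏ i, ∏ j ∈ ({i}ᶜ : Finset (Fin n)), qPoch q (z j / z i) τ =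
      MvPolynomial.eval z (selbergPoly q n τ) := by
    rw [eval_selbergPoly, ← Finset.prod_mul_distrib]
    refine Finset.prod_congr rfl fun i _ => ?_
    have h3 : z i ^ ((n - 1) * τ) = ∏ _j ∈ ({i}ᶜ : Finset (Fin n)), z i ^ τ := by
      rw [Finset.prod_const, Finset.card_compl, Finset.card_singleton, Fintype.card_fin, ← pow_mul,
        mul_comm]
    rw [h3, ← Finset.prod_mul_distrib]
    refine Finset.prod_congr rfl fun j _ => ?_
    rw [qPoch]
    conv_lhs => rw [← Finset.card_range τ, ← Finset.prod_const, Finset.card_range,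
      ← Finset.prod_mul_distrib]
    refine Finset.prod_congr rfl fun s _ => ?_
    have := hz i
    field_simp
  have h4 : integrand q n τ a₁ a₂ b₁ b₂ z =
      (∏ i, weight q a₁ a₂ b₁ b₂ (z i)) * MvPolynomial.eval z (selbergPoly q n τ) := by
    rw [← h2, ← h1, integrand]
    simp only [weight, Finset.prod_mul_distrib]
    ring
  rw [h4, MvPolynomial.eval_eq', Finset.mul_sum]
  refine Finset.sum_congr rfl fun d _ => ?_
  rw [Finset.prod_mul_distrib]
  ring

lemma jacksonConverges_integrand {q : ℝ} (hq0 : 0 < q) (hq1 : q < 1) (n τ : ℕ)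
    {a₁ a₂ b₁ b₂ : ℂ} (h : Admissible q a₁ a₂ b₁ b₂) :
    JacksonConverges q a₁ a₂ n (integrand q n τ a₁ a₂ b₁ b₂) :=
  (jacksonConverges_sum_prod (selbergPoly q n τ).support (fun d => (selbergPoly q n τ).coeff d)
    (fun d i z => weight q a₁ a₂ b₁ b₂ z * z ^ d i)
    fun d i => h.jacksonSummable hq0 hq1 (d i)).congr hq0 h.a₁_ne h.a₂_ne
      fun _ hz => (integrand_eq a₁ a₂ b₁ b₂ hz).symm

lemma iteratedJackson_integrand {q : ℝ} (hq0 : 0 < q) (hq1 : q < 1) (n τ : ℕ)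
    {a₁ a₂ b₁ b₂ : ℂ} (h : Admissible q a₁ a₂ b₁ b₂) :
    iteratedJackson q a₁ a₂ n (integrand q n τ a₁ a₂ b₁ b₂) =
      momentFunctional (fun _ => jacksonMoment q a₁ a₂ b₁ b₂) (selbergPoly q n τ) := by
  rw [iteratedJackson_congr hq0 h.a₁_ne h.a₂_ne fun z hz => integrand_eq a₁ a₂ b₁ b₂ hz,
    iteratedJackson_sum_prod (selbergPoly q n τ).support (fun d => (selbergPoly q n τ).coeff d)
    (fun d i z => weight q a₁ a₂ b₁ b₂ z * z ^ d i) fun d i => h.jacksonSummable hq0 hq1 (d i)]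
  rfl

/-- The `j`-th factor, `0 ≤ j < n`, of the value of the `q`-Selberg integral. -/
def selbergFactor (q : ℝ) (n τ : ℕ) (a₁ a₂ b₁ b₂ : ℂ) (j : ℕ) : ℂ :=
  (qPochInf q (q : ℂ) * qPochInf q ((q : ℂ) ^ τ) *
      qPochInf q (a₁ * a₂ * b₁ * b₂ * ((q : ℂ) ^ τ) ^ (n - 1 + j)) *
      (a₁ * a₂ * ((q : ℂ) ^ τ) ^ j) ^ ((n - 1 - j) * τ) * a₂ * theta q (a₁ / a₂)) /
    (qPochInf q (((q : ℂ) ^ τ) ^ (j + 1)) *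
      qPochInf q (a₁ * b₁ * ((q : ℂ) ^ τ) ^ j) *
      qPochInf q (a₁ * b₂ * ((q : ℂ) ^ τ) ^ j) *
      qPochInf q (a₂ * b₁ * ((q : ℂ) ^ τ) ^ j) *
      qPochInf q (a₂ * b₂ * ((q : ℂ) ^ τ) ^ j))

lemma qPochInf_t_pow_ne_zero {q : ℝ} (hq0 : 0 < q) (hq1 : q < 1) {τ : ℕ} (hτ : 0 < τ) (j : ℕ) :
    qPochInf q (((q : ℂ) ^ τ) ^ (j + 1)) ≠ 0 :=
  qPochInf_ne_zero hq0 hq1 fun m => by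
    rw [← pow_mul, ← pow_add]
    exact q_pow_ne_one hq0 hq1 (by positivity)

lemma qPochInf_mul_t_pow_ne_zero {q : ℝ} (hq0 : 0 < q) (hq1 : q < 1) {c : ℂ}
    (hc : ∀ m : ℕ, c * (q : ℂ) ^ m ≠ 1) (τ j : ℕ) : qPochInf q (c * ((q : ℂ) ^ τ) ^ j) ≠ 0 :=
  qPochInf_ne_zero hq0 hq1 fun m => by
    rw [mul_assoc, ← pow_mul, ← pow_add]
    exact hc _

/-- Each factor is the total mass of the one-dimensional weight times a finite product. -/
lemma selbergFactor_eq {q : ℝ} (hq0 : 0 < q) (hq1 : q < 1) {n τ : ℕ} (hτ : 0 < τ)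
    {a₁ a₂ b₁ b₂ : ℂ} (h : Admissible q a₁ a₂ b₁ b₂) (j : ℕ) :
    (1 - (q : ℂ)) * selbergFactor q n τ a₁ a₂ b₁ b₂ j *
        qPoch q (a₁ * a₂ * b₁ * b₂) ((n - 1) * τ + j * τ) =
      jacksonMoment q a₁ a₂ b₁ b₂ 0 * (qPoch q ((q : ℂ) ^ τ) (j * τ) *
        (a₁ * a₂ * (q : ℂ) ^ (j * τ)) ^ ((n - 1 - j) * τ) *
        (qPoch q (a₁ * b₁) (j * τ) * qPoch q (a₁ * b₂) (j * τ) *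
        qPoch q (a₂ * b₁) (j * τ) * qPoch q (a₂ * b₂) (j * τ))) := by
  have split : ∀ (c : ℂ) (m : ℕ), qPochInf q c =
      qPoch q c (m * τ) * qPochInf q (c * ((q : ℂ) ^ τ) ^ m) := by
    intro c m
    rw [qPochInf_eq_qPoch_mul q hq0 hq1 c (m * τ), mul_comm c, ← pow_mul, mul_comm τ]
  have n0 := qPochInf_t_pow_ne_zero hq0 hq1 hτ j
  have n1 := qPochInf_mul_t_pow_ne_zero hq0 hq1 h.h₁₁ τ j
  have n2 := qPochInf_mul_t_pow_ne_zero hq0 hq1 h.h₁₂ τ j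
  have n3 := qPochInf_mul_t_pow_ne_zero hq0 hq1 h.h₂₁ τ j
  have n4 := qPochInf_mul_t_pow_ne_zero hq0 hq1 h.h₂₂ τ j
  have m1 := qPochInf_ne_zero hq0 hq1 h.h₁₁
  have m2 := qPochInf_ne_zero hq0 hq1 h.h₁₂
  have m3 := qPochInf_ne_zero hq0 hq1 h.h₂₁
  have m4 := qPochInf_ne_zero hq0 hq1 h.h₂₂
  have hJ := jacksonMoment_eq_base hq0 hq1 h
  rw [jacksonMoment_base hq0 hq1 h.a₁_ne h.a₂_ne, split (a₁ * a₂ * b₁ * b₂) (n - 1 + j),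
    add_mul] at hJ
  have ht := split ((q : ℂ) ^ τ) j
  rw [← pow_succ'] at ht
  rw [split (a₁ * b₁) j] at hJ m1
  rw [split (a₁ * b₂) j] at hJ m2
  rw [split (a₂ * b₁) j] at hJ m3
  rw [split (a₂ * b₂) j] at hJ m4
  rw [selbergFactor, ht, ← pow_mul (q : ℂ) τ j, mul_comm τ j] at *
  generalize qPochInf q (((q : ℂ) ^ τ) ^ (j + 1)) = T at *
  generalize qPochInf q (a₁ * b₁ * (q : ℂ) ^ (j * τ)) = A at *
  generalize qPochInf q (a₁ * b₂ * (q : ℂ) ^ (j * τ)) = B at *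
  generalize qPochInf q (a₂ * b₁ * (q : ℂ) ^ (j * τ)) = G at *
  generalize qPochInf q (a₂ * b₂ * (q : ℂ) ^ (j * τ)) = E at *
  generalize qPochInf q (a₁ * a₂ * b₁ * b₂ * ((q : ℂ) ^ τ) ^ (n - 1 + j)) = F at *
  generalize qPoch q (a₁ * a₂ * b₁ * b₂) ((n - 1) * τ + j * τ) = F' at *
  generalize (a₁ * a₂ * (q : ℂ) ^ (j * τ)) ^ ((n - 1 - j) * τ) = R at *
  generalize jacksonMoment q a₁ a₂ b₁ b₂ 0 = J at *
  generalize theta q (a₁ / a₂) = θ at *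
  generalize qPochInf q (q : ℂ) = Q at *
  rw [mul_div_assoc', div_mul_eq_mul_div, div_eq_iff (by simp only [mul_ne_zero_iff]; tauto)]
  linear_combination -(T * qPoch q ((q : ℂ) ^ τ) (j * τ) * R) * hJ

/-- The formula away from the degenerate parameters. -/
lemma momentFunctional_eq_of_generic {q : ℝ} (hq0 : 0 < q) (hq1 : q < 1) {n τ : ℕ} (hτ : 0 < τ)
    {a₁ a₂ b₁ b₂ : ℂ} (h : Admissible q a₁ a₂ b₁ b₂) (hb₁ : b₁ ≠ 0) (hb₂ : b₂ ≠ 0)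
    (hY : ∀ m : ℕ, a₁ * a₂ * b₁ * b₂ * (q : ℂ) ^ m ≠ 1) :
    momentFunctional (fun _ => jacksonMoment q a₁ a₂ b₁ b₂) (selbergPoly q n τ) =
      (n.factorial : ℂ) * ((1 - (q : ℂ)) ^ n *
        ∏ j : Fin n, selbergFactor q n τ a₁ a₂ b₁ b₂ j) := by
  have ha₁ := h.a₁_ne
  have ha₂ := h.a₂_ne
  have hY0 : a₁ * a₂ * b₁ * b₂ ≠ 0 := by simp [ha₁, ha₂, hb₁, hb₂]
  have ex : a₁ * a₂ * b₁ * b₂ / (a₁ * b₁) = a₂ * b₂ := by field_simp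
  have ey : a₁ * a₂ * b₁ * b₂ / (a₂ * b₁) = a₁ * b₂ := by field_simp
  have hy : Generic q (a₁ * a₂ * b₁ * b₂) (a₂ * b₁) :=
    ⟨mul_ne_zero ha₂ hb₁, h.h₂₁, by rw [ey]; exact h.h₁₂⟩
  have key := selbergSum_eq hq0 hq1 n τ hτ hY0 hY hy (x := a₁ * b₁)
  rw [eval_mul, eval_mul, eval_upperFactor _ _ _ _ (mul_ne_zero ha₁ hb₁),
    eval_upperFactor _ _ _ _ (mul_ne_zero ha₂ hb₁), ex, ey, eval_lowerFactor, eval_lowerFactor]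
    at key
  have hI : b₁ ^ (halfDegree n τ * 2) *
      momentFunctional (fun _ => jacksonMoment q a₁ a₂ b₁ b₂) (selbergPoly q n τ) =
      selbergSum q n τ (a₁ * b₁) (a₂ * b₁) (a₁ * a₂ * b₁ * b₂) *
        jacksonMoment q a₁ a₂ b₁ b₂ 0 ^ n := by
    rw [← momentFunctional_mul_pow (isHomogeneous_selbergPoly q n τ)]
    simp only [jacksonMoment_eq_newtonMoment hq0 hq1 h hY]
    rw [momentFunctional_mul_const, selbergSum]
  have hW : ∏ j : Fin n, qPoch q (a₁ * a₂ * b₁ * b₂) ((n - 1) * τ + j * τ) ≠ 0 :=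
    Finset.prod_ne_zero_iff.mpr fun _ _ => qPoch_ne_zero fun m _ => hY m
  have hprod : (1 - (q : ℂ)) ^ n * (∏ j : Fin n, selbergFactor q n τ a₁ a₂ b₁ b₂ j) *
      ∏ j : Fin n, qPoch q (a₁ * a₂ * b₁ * b₂) ((n - 1) * τ + j * τ) =
      jacksonMoment q a₁ a₂ b₁ b₂ 0 ^ n * ((∏ j : Fin n, qPoch q ((q : ℂ) ^ τ) (j * τ)) *
        ((a₁ * a₂) ^ halfDegree n τ * ∏ j : Fin n, ((q : ℂ) ^ ((j : ℕ) * τ)) ^ ((n - 1 - j) * τ)) *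
        ((∏ j : Fin n, qPoch q (a₁ * b₁) (j * τ)) * (∏ j : Fin n, qPoch q (a₁ * b₂) (j * τ)) *
        (∏ j : Fin n, qPoch q (a₂ * b₁) (j * τ)) * ∏ j : Fin n, qPoch q (a₂ * b₂) (j * τ))) := by
    have hh : halfDegree n τ = ∑ j : Fin n, (n - 1 - j) * τ := by
      rw [halfDegree, Fin.sum_univ_eq_sum_range (fun j => j * τ),
        Fin.sum_univ_eq_sum_range (fun j => (n - 1 - j) * τ),
        Finset.sum_range_reflect (fun j => j * τ)]
    have hc : ∀ c : ℂ, c ^ n = ∏ _j : Fin n, c := fun c => by simp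
    rw [hh, ← Finset.prod_pow_eq_pow_sum, hc, hc]
    simp only [← Finset.prod_mul_distrib]
    refine Finset.prod_congr rfl fun j _ => ?_
    rw [selbergFactor_eq hq0 hq1 hτ h j, mul_pow (a₁ * a₂)]
  refine mul_left_cancel₀ (mul_ne_zero (pow_ne_zero (halfDegree n τ * 2) hb₁) hW) ?_
  rw [Finset.prod_mul_distrib] at key
  generalize (∏ j : Fin n, qPoch q (a₁ * a₂ * b₁ * b₂) ((n - 1) * τ + j * τ)) = W at *
  generalize (∏ j : Fin n, selbergFactor q n τ a₁ a₂ b₁ b₂ j) = S at *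
  generalize momentFunctional (fun _ => jacksonMoment q a₁ a₂ b₁ b₂) (selbergPoly q n τ) = I at *
  have e0 : (a₁ * b₁) ^ halfDegree n τ * (a₂ * b₁) ^ halfDegree n τ =
      (a₁ * a₂) ^ halfDegree n τ * b₁ ^ (halfDegree n τ * 2) := by
    rw [mul_comm (halfDegree n τ) 2, pow_mul b₁, ← mul_pow, ← mul_pow]; congr 1; ring
  generalize jacksonMoment q a₁ a₂ b₁ b₂ 0 ^ n = J at *
  generalize selbergSum q n τ (a₁ * b₁) (a₂ * b₁) (a₁ * a₂ * b₁ * b₂) = F at *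
  generalize (∏ j : Fin n, qPoch q ((q : ℂ) ^ τ) (j * τ)) = p1 at *
  generalize (∏ j : Fin n, ((q : ℂ) ^ ((j : ℕ) * τ)) ^ ((n - 1 - j) * τ)) = p2 at *
  generalize (∏ j : Fin n, qPoch q (a₁ * b₁) (j * τ)) = p3 at *
  generalize (∏ j : Fin n, qPoch q (a₁ * b₂) (j * τ)) = p4 at *
  generalize (∏ j : Fin n, qPoch q (a₂ * b₁) (j * τ)) = p5 at *
  generalize (∏ j : Fin n, qPoch q (a₂ * b₂) (j * τ)) = p6 at *
  linear_combination W * hI + J * key - b₁ ^ (halfDegree n τ * 2) * n.factorial * hprod +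
    (n.factorial : ℂ) * J * p1 * p2 * p3 * p4 * p5 * p6 * e0

lemma continuousAt_momentFunctional {q : ℝ} (hq0 : 0 < q) (hq1 : q < 1) (n τ : ℕ)
    {a₁ a₂ b₁ b₂ : ℂ} (h : Admissible q a₁ a₂ b₁ b₂) :
    ContinuousAt (fun p : ℂ × ℂ => momentFunctional (fun _ => jacksonMoment q a₁ a₂ p.1 p.2)
      (selbergPoly q n τ)) (b₁, b₂) := by
  unfold momentFunctional
  refine tendsto_finsetSum _ fun d _ => Tendsto.const_smul ?_ _
  exact tendsto_finsetProd _ fun i _ => continuousAt_jacksonMoment hq0 hq1 h (d i)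

lemma continuousAt_selbergFactor {q : ℝ} (hq0 : 0 < q) (hq1 : q < 1) {n τ : ℕ} (hτ : 0 < τ)
    {a₁ a₂ b₁ b₂ : ℂ} (h : Admissible q a₁ a₂ b₁ b₂) (j : ℕ) :
    ContinuousAt (fun p : ℂ × ℂ => selbergFactor q n τ a₁ a₂ p.1 p.2 j) (b₁, b₂) := by
  have hc : ∀ f : ℂ × ℂ → ℂ, Continuous f → ContinuousAt (fun p => qPochInf q (f p)) (b₁, b₂) :=
    fun f hf => ((continuous_qPochInf hq0 hq1).comp hf).continuousAt
  unfold selbergFactor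
  refine ContinuousAt.div ?_ ?_ ?_
  · exact (((continuousAt_const.mul (hc _ (by fun_prop))).mul continuousAt_const).mul
      continuousAt_const).mul continuousAt_const
  · exact (((continuousAt_const.mul (hc _ (by fun_prop))).mul (hc _ (by fun_prop))).mul
      (hc _ (by fun_prop))).mul (hc _ (by fun_prop))
  · exact mul_ne_zero (mul_ne_zero (mul_ne_zero (mul_ne_zero (qPochInf_t_pow_ne_zero hq0 hq1 hτ j)
      (qPochInf_mul_t_pow_ne_zero hq0 hq1 h.h₁₁ τ j))
      (qPochInf_mul_t_pow_ne_zero hq0 hq1 h.h₁₂ τ j))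
      (qPochInf_mul_t_pow_ne_zero hq0 hq1 h.h₂₁ τ j))
      (qPochInf_mul_t_pow_ne_zero hq0 hq1 h.h₂₂ τ j)

lemma eq_of_eq_off_countable {f g : ℂ → ℂ} {b : ℂ} (hf : ContinuousAt f b) (hg : ContinuousAt g b)
    {s : Set ℂ} (hs : s.Countable) (h : ∀ c ∉ s, f c = g c) : f b = g b := by
  have hd : Dense sᶜ := hs.dense_compl ℝ
  have : (𝓝[sᶜ] b).NeBot := mem_closure_iff_nhdsWithin_neBot.mp (hd b)
  refine tendsto_nhds_unique (l := 𝓝[sᶜ] b) (hf.mono_left nhdsWithin_le_nhds)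
    ((hg.mono_left nhdsWithin_le_nhds).congr' ?_)
  filter_upwards [self_mem_nhdsWithin] with c hc using (h c hc).symm

lemma countable_setOf_mul_pow_eq_one (q : ℝ) (a : ℂ) :
    {b : ℂ | ∃ m : ℕ, a * b * (q : ℂ) ^ m = 1}.Countable := by
  refine (Set.countable_range fun m : ℕ => (a * (q : ℂ) ^ m)⁻¹).mono ?_
  rintro b ⟨m, hm⟩
  exact ⟨m, (eq_inv_of_mul_eq_one_left (by rw [← hm]; ring)).symm⟩

lemma momentFunctional_eq {q : ℝ} (hq0 : 0 < q) (hq1 : q < 1) {n τ : ℕ} (hτ : 0 < τ)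
    {a₁ a₂ b₁ b₂ : ℂ} (h : Admissible q a₁ a₂ b₁ b₂) :
    momentFunctional (fun _ => jacksonMoment q a₁ a₂ b₁ b₂) (selbergPoly q n τ) =
      (n.factorial : ℂ) * ((1 - (q : ℂ)) ^ n *
        ∏ j : Fin n, selbergFactor q n τ a₁ a₂ b₁ b₂ j) := by
  have ha₁ := h.a₁_ne
  have ha₂ := h.a₂_ne
  have hR : ∀ b₁ b₂ : ℂ, Admissible q a₁ a₂ b₁ b₂ → ContinuousAt (fun p : ℂ × ℂ =>
      (n.factorial : ℂ) * ((1 - (q : ℂ)) ^ n *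
        ∏ j : Fin n, selbergFactor q n τ a₁ a₂ p.1 p.2 j)) (b₁, b₂) := fun b₁ b₂ h =>
    continuousAt_const.mul (continuousAt_const.mul
      (tendsto_finsetProd _ fun j _ => continuousAt_selbergFactor hq0 hq1 hτ h j))
  -- first `b₁` becomes arbitrary, with `b₂ ≠ 0`
  have step : ∀ b₁ b₂ : ℂ, b₂ ≠ 0 → Admissible q a₁ a₂ b₁ b₂ →
      momentFunctional (fun _ => jacksonMoment q a₁ a₂ b₁ b₂) (selbergPoly q n τ) =
      (n.factorial : ℂ) * ((1 - (q : ℂ)) ^ n *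
        ∏ j : Fin n, selbergFactor q n τ a₁ a₂ b₁ b₂ j) := by
    intro b₁ b₂ hb₂ h
    have hpath : ContinuousAt (fun b : ℂ => (b, b₂)) b₁ := by fun_prop
    refine eq_of_eq_off_countable
      (f := fun b => momentFunctional (fun _ => jacksonMoment q a₁ a₂ b b₂) (selbergPoly q n τ))
      (g := fun b => (n.factorial : ℂ) * ((1 - (q : ℂ)) ^ n *
        ∏ j : Fin n, selbergFactor q n τ a₁ a₂ b b₂ j))
      (ContinuousAt.comp (f := fun b : ℂ => (b, b₂))
        (continuousAt_momentFunctional hq0 hq1 n τ h) hpath)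
      (ContinuousAt.comp (f := fun b : ℂ => (b, b₂)) (hR b₁ b₂ h) hpath)
      (((Set.countable_singleton (0 : ℂ)).union (countable_setOf_mul_pow_eq_one q a₁)).union
        ((countable_setOf_mul_pow_eq_one q a₂).union
          (countable_setOf_mul_pow_eq_one q (a₁ * a₂ * b₂)))) ?_
    intro b hb
    simp only [Set.mem_union, Set.mem_singleton_iff, Set.mem_ofPred_eq, not_or, not_exists] at hb
    obtain ⟨⟨k0, k1⟩, k2, k3⟩ := hb
    refine momentFunctional_eq_of_generic hq0 hq1 hτ ⟨ha₁, ha₂, k1, h.h₁₂, k2, h.h₂₂⟩ k0 hb₂ ?_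
    intro m e
    exact k3 m (by rw [← e]; ring)
  have hpath : ContinuousAt (fun b : ℂ => (b₁, b)) b₂ := by fun_prop
  refine eq_of_eq_off_countable
    (f := fun b => momentFunctional (fun _ => jacksonMoment q a₁ a₂ b₁ b) (selbergPoly q n τ))
    (g := fun b => (n.factorial : ℂ) * ((1 - (q : ℂ)) ^ n *
      ∏ j : Fin n, selbergFactor q n τ a₁ a₂ b₁ b j))
    (ContinuousAt.comp (f := fun b : ℂ => (b₁, b))
      (continuousAt_momentFunctional hq0 hq1 n τ h) hpath)
    (ContinuousAt.comp (f := fun b : ℂ => (b₁, b)) (hR b₁ b₂ h) hpath)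
    ((Set.countable_singleton (0 : ℂ)).union ((countable_setOf_mul_pow_eq_one q a₁).union
      (countable_setOf_mul_pow_eq_one q a₂))) ?_
  intro b hb
  simp only [Set.mem_union, Set.mem_singleton_iff, Set.mem_ofPred_eq, not_or, not_exists] at hb
  exact step b₁ b hb.1 ⟨ha₁, ha₂, h.h₁₁, hb.2.1, h.h₂₁, hb.2.2⟩

lemma prod_Icc_one_eq (f : ℕ → ℂ) (n : ℕ) :
    ∏ j ∈ Finset.Icc 1 n, f j = ∏ j : Fin n, f (j + 1) := by
  rw [Fin.prod_univ_eq_prod_range (fun j => f (j + 1)), Finset.range_eq_Ico,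
    Finset.prod_Ico_add' f 0 n 1]
  rfl

/-- The `q`-Selberg integral over `[a₁, a₂]^n`. -/
theorem iteratedJackson_integrand_eq {q : ℝ} (hq0 : 0 < q) (hq1 : q < 1) {n τ : ℕ} (hτ : 0 < τ)
    {a₁ a₂ b₁ b₂ : ℂ} (h : Admissible q a₁ a₂ b₁ b₂) :
    1 / (n.factorial : ℂ) * iteratedJackson q a₁ a₂ n (integrand q n τ a₁ a₂ b₁ b₂) =
      (1 - (q : ℂ)) ^ n * ∏ j : Fin n, selbergFactor q n τ a₁ a₂ b₁ b₂ j := by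
  have hn : (n.factorial : ℂ) ≠ 0 := Nat.cast_ne_zero.mpr n.factorial_ne_zero
  rw [iteratedJackson_integrand hq0 hq1 n τ h, momentFunctional_eq hq0 hq1 hτ h, ← mul_assoc,
    one_div_mul_cancel hn, one_mul]

/-! ### The Askey--Evans form -/

lemma jackson_const_mul (q : ℝ) (a b c : ℂ) (f : ℂ → ℂ) :
    jackson q a b (fun z => c * f z) = c * jackson q a b f := by
  simp only [jackson, jacksonFromZero, mul_assoc c, tsum_mul_left]
  ring

lemma iteratedJackson_const_mul (q : ℝ) (a b c : ℂ) {n : ℕ} (f : (Fin n → ℂ) → ℂ) :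
    iteratedJackson q a b n (fun z => c * f z) = c * iteratedJackson q a b n f := by
  induction n with
  | zero => rfl
  | succ n ih => simp only [iteratedJackson, ih, jackson_const_mul]

lemma JacksonConverges.const_mul {q : ℝ} {a b : ℂ} {n : ℕ} {f : (Fin n → ℂ) → ℂ}
    (hf : JacksonConverges q a b n f) (c : ℂ) :
    JacksonConverges q a b n fun z => c * f z := by
  intro e he
  simpa only [mul_assoc, norm_mul c] using (hf e he).mul_left ‖c‖

/-- The interaction of two variables in the two integrands, up to the constant
`(-1)^τ q^(-τ(τ-1)/2)`. -/
lemma prod_Icc_sub_zpow {q : ℝ} (hq0 : 0 < q) {τ : ℕ} (hτ : 0 < τ) {u v : ℂ} (hu : u ≠ 0)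
    (hv : v ≠ 0) :
    (∏ l ∈ Finset.Icc (1 - (τ : ℤ)) ((τ : ℤ) - 1), (u - (q : ℂ) ^ l * v)) * (u - v) =
      (-1) ^ τ * ((q : ℂ) ^ τ.choose 2)⁻¹ * (u ^ τ * v ^ τ) *
        (qPoch q (u / v) τ * qPoch q (v / u) τ) := by
  have hq := ofReal_q_ne_zero hq0
  induction τ, hτ using Nat.le_induction with
  | base =>
    simp only [Nat.succ_eq_add_one, zero_add, Nat.cast_one, sub_self, Finset.Icc_self,
      Finset.prod_singleton, zpow_zero, one_mul, qPoch, Finset.prod_range_one, pow_zero, pow_one]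
    norm_num
    field_simp
    ring
  | succ τ hτ ih =>
    have hI : Finset.Icc (1 - ((τ + 1 : ℕ) : ℤ)) (((τ + 1 : ℕ) : ℤ) - 1) =
        insert (τ : ℤ) (insert (-(τ : ℤ)) (Finset.Icc (1 - (τ : ℤ)) ((τ : ℤ) - 1))) := by
      ext l
      simp only [Finset.mem_insert, Finset.mem_Icc]
      push_cast
      omega
    rw [hI, Finset.prod_insert, Finset.prod_insert, mul_assoc, mul_assoc, ih, qPoch_succ,
      qPoch_succ, Nat.choose_succ_succ' τ 1, Nat.choose_one_right, zpow_neg, zpow_natCast]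
    · have : (q : ℂ) ^ τ ≠ 0 := pow_ne_zero _ hq
      rw [pow_add (q : ℂ) τ, pow_succ u, pow_succ v, pow_succ (-1 : ℂ)]
      generalize qPoch q (u / v) τ = A
      generalize qPoch q (v / u) τ = B
      field_simp
      ring
    · simp only [Finset.mem_Icc, not_and, not_le]; omega
    · simp only [Finset.mem_insert, Finset.mem_Icc, not_or, not_and, not_le]; omega

lemma sum_card_Ioi (n : ℕ) : ∑ j : Fin n, (Finset.Ioi j).card = n.choose 2 := by
  simp only [Fin.card_Ioi]
  rw [Fin.sum_univ_eq_sum_range (fun j => n - 1 - j), Finset.sum_range_reflect (fun j => j),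
    Finset.sum_range_id, Nat.choose_two_right]

lemma sum_mul_reflect (n : ℕ) : ∑ j ∈ Finset.range n, j * (n - 1 - j) = n.choose 3 := by
  induction n with
  | zero => rfl
  | succ n ih =>
    rw [Finset.sum_range_succ, Nat.choose_succ_succ' n 2, ← ih, Nat.choose_two_right,
      ← Finset.sum_range_id, ← Finset.sum_add_distrib]
    have : n * (n + 1 - 1 - n) = 0 := by simp
    rw [this, add_zero]
    refine Finset.sum_congr rfl fun j hj => ?_
    have hj := Finset.mem_range.mp hj
    have : n + 1 - 1 - j = n - 1 - j + 1 := by omega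
    rw [this]; ring

lemma cpow_add_natCast_mul {r : ℂ} (hr : r ≠ 0) (α : ℂ) (m τ : ℕ) :
    r ^ (α + (m : ℂ) * τ) = r ^ α * (r ^ τ) ^ m := by
  rw [Complex.cpow_add _ _ hr, ← Nat.cast_mul, Complex.cpow_natCast, ← pow_mul, mul_comm m]

/-- The two integrands agree up to a constant for `b₁ = q^α / x₁` and `b₂ = q^β / x₂`. -/
lemma askeyEvansIntegrand_eq {q : ℝ} (hq0 : 0 < q) {n τ : ℕ} (hτ : 0 < τ)
    {x₁ x₂ : ℂ} (hx₁ : x₁ ≠ 0) (hx₂ : x₂ ≠ 0) (α β : ℂ) {z : Fin n → ℂ} (hz : ∀ i, z i ≠ 0) :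
    askeyEvansIntegrand q n τ x₁ x₂ α β z =
      ((-1) ^ τ * ((q : ℂ) ^ τ.choose 2)⁻¹) ^ n.choose 2 *
        integrand q n τ x₁ x₂ ((q : ℂ) ^ α / x₁) ((q : ℂ) ^ β / x₂) z := by
  have hq := ofReal_q_ne_zero hq0
  obtain ⟨W, hW⟩ : ∃ W : ℂ → ℂ → ℂ → ℂ, ∀ x γ w, qPochInf q ((q : ℂ) * x⁻¹ * w) /
      qPochInf q ((q : ℂ) ^ γ / x * w) = W x γ w := ⟨_, fun _ _ _ => rfl⟩
  have hC : ∀ x γ w : ℂ, x ≠ 0 → qPochC q ((q : ℂ) * w / x) (γ - 1) = W x γ w := by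
    intro x γ w hx
    rw [← hW, qPochC, Complex.cpow_sub _ _ hq, Complex.cpow_one]
    congr 2 <;> field_simp
  have hpow := Finset.prod_prod_Ioi_mul_eq_prod_prod_off_diag fun _ i : Fin n => z i ^ τ
  simp only [Finset.prod_const, Finset.card_compl, Finset.card_singleton, Fintype.card_fin,
    ← pow_mul, mul_comm τ] at hpow
  rw [askeyEvansIntegrand, integrand, mul_assoc]
  simp only [← Finset.prod_mul_distrib, hC _ _ _ hx₁, hC _ _ _ hx₂, hW]
  simp only [prod_Icc_sub_zpow hq0 hτ (hz _) (hz _)]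
  rw [← sum_card_Ioi n, ← Finset.prod_pow_eq_pow_sum]
  simp only [Finset.prod_mul_distrib, Finset.prod_const, mul_pow] at hpow ⊢
  rw [← hpow]
  ring

lemma qGamma_add_natCast_mul {q : ℝ} (hq0 : 0 < q) (hq1 : q < 1) (α : ℂ) (m τ : ℕ) :
    qGamma q (α + (m : ℂ) * τ) = (1 - (q : ℂ)) * qPochInf q (q : ℂ) /
      ((1 - (q : ℂ)) ^ α * ((1 - (q : ℂ)) ^ τ) ^ m *
        qPochInf q ((q : ℂ) ^ α * ((q : ℂ) ^ τ) ^ m)) := by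
  have hr : (1 : ℂ) - q ≠ 0 := sub_ne_zero.mpr (by
    simpa using (q_pow_ne_one hq0 hq1 one_ne_zero).symm)
  rw [qGamma, Complex.cpow_sub _ _ hr, cpow_add_natCast_mul hr,
    cpow_add_natCast_mul (ofReal_q_ne_zero hq0), Complex.cpow_one, div_mul_eq_mul_div, div_div]

/-- The `j`-th factor, `0 ≤ j < n`, of the Askey--Evans formula. -/
def askeyEvansFactor (q : ℝ) (n τ : ℕ) (x₁ x₂ α β : ℂ) (j : ℕ) : ℂ :=
  (qGamma q (α + (j : ℂ) * τ) * qGamma q (β + (j : ℂ) * τ) * qGamma q (((j + 1 : ℕ) : ℂ) * τ)) /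
    (qGamma q (α + β + ((n - 1 + j : ℕ) : ℂ) * τ) * qGamma q (τ : ℂ)) *
    ((x₁ * x₂) ^ (1 + j * τ) / (x₁ - x₂)) *
    qPochC q (x₂ / x₁) (α + (j : ℂ) * τ) * qPochC q (x₁ / x₂) (β + (j : ℂ) * τ)

/-- Comparison of the factors of the two formulas. The extra powers with exponents `jτ` and
`(n-1-j)τ` cancel in the product over `j`, by the reflection `j ↦ n-1-j`. -/
lemma askeyEvansFactor_mul {q : ℝ} (hq0 : 0 < q) (hq1 : q < 1) {n τ : ℕ} (hτ : 0 < τ)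
    {x₁ x₂ : ℂ} (α β : ℂ) (h : Admissible q x₁ x₂ ((q : ℂ) ^ α / x₁) ((q : ℂ) ^ β / x₂))
    (hx : x₁ ≠ x₂) {j : ℕ} (hj : j < n) :
    askeyEvansFactor q n τ x₁ x₂ α β j * ((1 - (q : ℂ)) * (x₁ * x₂)⁻¹) ^ (j * τ) *
        ((x₁ * x₂) * (1 - (q : ℂ))⁻¹) ^ ((n - 1 - j) * τ) * (q : ℂ) ^ (τ ^ 2 * (j * (n - 1 - j))) =
      (1 - (q : ℂ)) * selbergFactor q n τ x₁ x₂ ((q : ℂ) ^ α / x₁) ((q : ℂ) ^ β / x₂) j := by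
  have hx₁ := h.a₁_ne
  have hx₂ := h.a₂_ne
  have hq := ofReal_q_ne_zero hq0
  have hr : (1 : ℂ) - q ≠ 0 := sub_ne_zero.mpr (by
    simpa using (q_pow_ne_one hq0 hq1 one_ne_zero).symm)
  have hd : x₁ - x₂ ≠ 0 := sub_ne_zero.mpr hx
  have hα : (1 - (q : ℂ)) ^ α ≠ 0 := fun h => hr (Complex.cpow_eq_zero_iff _ _ |>.mp h).1
  have hβ : (1 - (q : ℂ)) ^ β ≠ 0 := fun h => hr (Complex.cpow_eq_zero_iff _ _ |>.mp h).1
  have e1 : x₁ * ((q : ℂ) ^ α / x₁) = (q : ℂ) ^ α := by field_simp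
  have e2 : x₁ * ((q : ℂ) ^ β / x₂) = (q : ℂ) ^ β * (x₁ / x₂) := by ring
  have e3 : x₂ * ((q : ℂ) ^ α / x₁) = (q : ℂ) ^ α * (x₂ / x₁) := by ring
  have e4 : x₂ * ((q : ℂ) ^ β / x₂) = (q : ℂ) ^ β := by field_simp
  have e5 : x₁ * x₂ * ((q : ℂ) ^ α / x₁) * ((q : ℂ) ^ β / x₂) = (q : ℂ) ^ α * (q : ℂ) ^ β := by
    field_simp
  have n0 := qPochInf_t_pow_ne_zero hq0 hq1 hτ j
  have n5 := qPochInf_t_pow_ne_zero hq0 hq1 hτ 0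
  have n1 := qPochInf_mul_t_pow_ne_zero hq0 hq1 h.h₁₁ τ j
  have n2 := qPochInf_mul_t_pow_ne_zero hq0 hq1 h.h₁₂ τ j
  have n3 := qPochInf_mul_t_pow_ne_zero hq0 hq1 h.h₂₁ τ j
  have n4 := qPochInf_mul_t_pow_ne_zero hq0 hq1 h.h₂₂ τ j
  have nq := qPochInf_q_ne_zero hq0 hq1
  rw [e1] at n1
  rw [e2] at n2
  rw [e3] at n3
  rw [e4] at n4
  rw [zero_add, pow_one] at n5
  have g1 := qGamma_add_natCast_mul hq0 hq1 0 (j + 1) τ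
  have g2 := qGamma_add_natCast_mul hq0 hq1 0 1 τ
  rw [zero_add, Complex.cpow_zero, Complex.cpow_zero, one_mul, one_mul] at g1 g2
  rw [Nat.cast_one, one_mul, pow_one, pow_one] at g2
  have hθ : x₂ * theta q (x₁ / x₂) * (x₁ - x₂) =
      x₁ * x₂ * (qPochInf q (x₂ / x₁) * qPochInf q (x₁ / x₂)) := by
    have f1 := qPochInf_succ hq0 hq1 (x₂ / x₁)
    have f2 : (q : ℂ) / (x₁ / x₂) = q * (x₂ / x₁) := by field_simp
    rw [theta, f2, f1]
    generalize qPochInf q (q * (x₂ / x₁)) = A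
    generalize qPochInf q (x₁ / x₂) = B
    field_simp
  have hex : (q : ℂ) ^ (τ ^ 2 * (j * (n - 1 - j))) =
      (((q : ℂ) ^ τ) ^ j) ^ ((n - 1 - j) * τ) := by
    rw [← pow_mul, ← pow_mul]; congr 1; ring
  obtain ⟨s, rfl⟩ : ∃ s, n = j + 1 + s := ⟨n - (j + 1), by omega⟩
  have es : j + 1 + s - 1 - j = s := by omega
  have es' : j + 1 + s - 1 + j = j + j + s := by omega
  rw [askeyEvansFactor, selbergFactor, g1, g2, qGamma_add_natCast_mul hq0 hq1,
    qGamma_add_natCast_mul hq0 hq1, qGamma_add_natCast_mul hq0 hq1, qPochC, qPochC,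
    cpow_add_natCast_mul hq, cpow_add_natCast_mul hq, e1, e2, e3, e4, e5, hex, es, es',
    Complex.cpow_add _ _ hr, Complex.cpow_add _ _ hq]
  rw [show (q : ℂ) ^ α * ((q : ℂ) ^ τ) ^ j * (x₂ / x₁) =
      (q : ℂ) ^ α * (x₂ / x₁) * ((q : ℂ) ^ τ) ^ j by ring,
    show (q : ℂ) ^ β * ((q : ℂ) ^ τ) ^ j * (x₁ / x₂) =
      (q : ℂ) ^ β * (x₁ / x₂) * ((q : ℂ) ^ τ) ^ j by ring]
  have hθ' : theta q (x₁ / x₂) = x₁ * x₂ * (qPochInf q (x₂ / x₁) * qPochInf q (x₁ / x₂)) /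
      (x₂ * (x₁ - x₂)) := by
    rw [eq_div_iff (mul_ne_zero hx₂ hd), ← hθ]; ring
  rw [hθ']
  generalize qPochInf q (((q : ℂ) ^ τ) ^ (j + 1)) = T1 at *
  generalize qPochInf q ((q : ℂ) ^ τ) = T at *
  generalize qPochInf q ((q : ℂ) ^ α * ((q : ℂ) ^ τ) ^ j) = A at *
  generalize qPochInf q ((q : ℂ) ^ β * ((q : ℂ) ^ τ) ^ j) = B at *
  generalize qPochInf q ((q : ℂ) ^ α * (x₂ / x₁) * ((q : ℂ) ^ τ) ^ j) = G at *
  generalize qPochInf q ((q : ℂ) ^ β * (x₁ / x₂) * ((q : ℂ) ^ τ) ^ j) = E at *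
  generalize qPochInf q ((q : ℂ) ^ α * (q : ℂ) ^ β * ((q : ℂ) ^ τ) ^ (j + j + s)) = F at *
  generalize qPochInf q (x₂ / x₁) = U at *
  generalize qPochInf q (x₁ / x₂) = V at *
  generalize qPochInf q (q : ℂ) = Q at *
  generalize (1 - (q : ℂ)) ^ α = rα at *
  generalize (1 - (q : ℂ)) ^ β = rβ at *
  generalize ((q : ℂ) ^ τ) ^ j = t' at *
  generalize (1 : ℂ) - q = r at *
  have hρ : r ^ τ ≠ 0 := pow_ne_zero _ hr
  -- at a pole of `Γ_q(α + β + (n-1+j)τ)` one has `F = 0`, and both sides are `0` since `1 / 0 = 0`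
  have main : r * Q / (rα * (r ^ τ) ^ j * A) * (r * Q / (rβ * (r ^ τ) ^ j * B)) *
      (r * Q / ((r ^ τ) ^ (j + 1) * T1)) /
      (r * Q / (rα * rβ * (r ^ τ) ^ (j + j + s) * F) * (r * Q / (r ^ τ * T))) =
      r * Q * T * F * (r ^ τ) ^ s / ((r ^ τ) ^ j * A * B * T1) := by
    generalize r ^ τ = ρ at *
    rw [div_mul_div_comm (r * Q) (_ * F), div_div_eq_mul_div, pow_add, pow_add, pow_succ]
    field_simp
    ring
  rw [main, mul_pow r, mul_pow (x₁ * x₂) r⁻¹, mul_pow (x₁ * x₂) t', pow_add (x₁ * x₂), pow_one,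
    inv_pow, inv_pow, ← pow_mul, ← pow_mul, mul_comm τ s, mul_comm τ j]
  have hX : x₁ * x₂ ≠ 0 := mul_ne_zero hx₁ hx₂
  have hX1 : (x₁ * x₂) ^ (j * τ) ≠ 0 := pow_ne_zero _ hX
  have hr1 : r ^ (j * τ) ≠ 0 := pow_ne_zero _ hr
  have hr2 : r ^ (s * τ) ≠ 0 := pow_ne_zero _ hr
  generalize (x₁ * x₂) ^ (j * τ) = X1 at *
  generalize (x₁ * x₂) ^ (s * τ) = X2 at *
  generalize r ^ (j * τ) = r1 at *
  generalize r ^ (s * τ) = r2 at *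
  generalize t' ^ (s * τ) = t2 at *
  generalize x₁ - x₂ = δ at *
  field_simp

/-- The right-hand sides of the two formulas agree. -/
theorem prod_askeyEvansFactor {q : ℝ} (hq0 : 0 < q) (hq1 : q < 1) {n τ : ℕ} (hτ : 0 < τ)
    {x₁ x₂ : ℂ} (α β : ℂ) (h : Admissible q x₁ x₂ ((q : ℂ) ^ α / x₁) ((q : ℂ) ^ β / x₂))
    (hx : x₁ ≠ x₂) :
    (q : ℂ) ^ (τ ^ 2 * n.choose 3) * ∏ j : Fin n, askeyEvansFactor q n τ x₁ x₂ α β j =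
      (1 - (q : ℂ)) ^ n *
        ∏ j : Fin n, selbergFactor q n τ x₁ x₂ ((q : ℂ) ^ α / x₁) ((q : ℂ) ^ β / x₂) j := by
  have hr : (1 : ℂ) - q ≠ 0 := sub_ne_zero.mpr (by
    simpa using (q_pow_ne_one hq0 hq1 one_ne_zero).symm)
  have hX : x₁ * x₂ ≠ 0 := mul_ne_zero h.a₁_ne h.a₂_ne
  have hc : (1 - (q : ℂ)) ^ n = ∏ _j : Fin n, (1 - (q : ℂ)) := by simp
  have h1 := Finset.prod_congr (s₁ := (Finset.univ : Finset (Fin n))) rfl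
    fun j _ => askeyEvansFactor_mul hq0 hq1 hτ α β h hx j.isLt
  rw [hc, ← Finset.prod_mul_distrib, ← h1]
  simp only [Finset.prod_mul_distrib, Finset.prod_pow_eq_pow_sum]
  have s1 : ∑ j : Fin n, (n - 1 - (j : ℕ)) * τ = ∑ j : Fin n, (j : ℕ) * τ := by
    rw [Fin.sum_univ_eq_sum_range (fun j => j * τ),
      Fin.sum_univ_eq_sum_range (fun j => (n - 1 - j) * τ),
      Finset.sum_range_reflect (fun j => j * τ)]
  have s2 : ∑ j : Fin n, τ ^ 2 * ((j : ℕ) * (n - 1 - j)) = τ ^ 2 * n.choose 3 := by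
    rw [← Finset.mul_sum, Fin.sum_univ_eq_sum_range (fun j => j * (n - 1 - j)), sum_mul_reflect]
  rw [s1, s2, mul_assoc (∏ j : Fin n, askeyEvansFactor q n τ x₁ x₂ α β j), ← mul_pow]
  have : (1 - (q : ℂ)) * (x₁ * x₂)⁻¹ * (x₁ * x₂ * (1 - (q : ℂ))⁻¹) = 1 := by
    generalize x₁ * x₂ = X at *
    field_simp
  rw [this, one_pow, mul_one, mul_comm]

end QSelberg

end

theorem mainTheorem6 (q : ℝ) (hq0 : 0 < q) (hq1 : q < 1) (n τ : ℕ) (hτ : 0 < τ) :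
    (∀ a₁ a₂ b₁ b₂ : ℂ, a₁ ≠ 0 → a₂ ≠ 0 →
      (∀ m : ℕ, a₁ * b₁ * (q : ℂ) ^ m ≠ 1) → (∀ m : ℕ, a₁ * b₂ * (q : ℂ) ^ m ≠ 1) →
      (∀ m : ℕ, a₂ * b₁ * (q : ℂ) ^ m ≠ 1) → (∀ m : ℕ, a₂ * b₂ * (q : ℂ) ^ m ≠ 1) →
      ∀ t : ℂ, t = (q : ℂ) ^ τ →
      QSelberg.JacksonConverges q a₁ a₂ n (QSelberg.integrand q n τ a₁ a₂ b₁ b₂) ∧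
      1 / (n.factorial : ℂ) *
          QSelberg.iteratedJackson q a₁ a₂ n (QSelberg.integrand q n τ a₁ a₂ b₁ b₂) =
        (1 - (q : ℂ)) ^ n * ∏ j ∈ Finset.Icc 1 n,
          (QSelberg.qPochInf q (q : ℂ) * QSelberg.qPochInf q t *
              QSelberg.qPochInf q (a₁ * a₂ * b₁ * b₂ * t ^ (n + j - 2)) *
              (a₁ * a₂ * t ^ (j - 1)) ^ ((n - j) * τ) * a₂ * QSelberg.theta q (a₁ / a₂)) /
            (QSelberg.qPochInf q (t ^ j) *
              QSelberg.qPochInf q (a₁ * b₁ * t ^ (j - 1)) *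
              QSelberg.qPochInf q (a₁ * b₂ * t ^ (j - 1)) *
              QSelberg.qPochInf q (a₂ * b₁ * t ^ (j - 1)) *
              QSelberg.qPochInf q (a₂ * b₂ * t ^ (j - 1)))) ∧
    (∀ x₁ x₂ α β : ℂ, x₁ ≠ 0 → x₂ ≠ 0 → x₁ ≠ x₂ →
      (∀ m : ℕ, (q : ℂ) ^ α * (q : ℂ) ^ m ≠ 1) → (∀ m : ℕ, (q : ℂ) ^ β * (q : ℂ) ^ m ≠ 1) →
      (∀ m : ℕ, (q : ℂ) ^ α * (x₂ / x₁) * (q : ℂ) ^ m ≠ 1) →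
      (∀ m : ℕ, (q : ℂ) ^ β * (x₁ / x₂) * (q : ℂ) ^ m ≠ 1) →
      QSelberg.JacksonConverges q x₁ x₂ n (QSelberg.askeyEvansIntegrand q n τ x₁ x₂ α β) ∧
      1 / (n.factorial : ℂ) *
          QSelberg.iteratedJackson q x₁ x₂ n (QSelberg.askeyEvansIntegrand q n τ x₁ x₂ α β) =
        (-1) ^ (τ * n.choose 2) *
          (q : ℂ) ^ ((τ ^ 2 * n.choose 3 : ℤ) - (τ.choose 2 * n.choose 2 : ℤ)) *
          ∏ j ∈ Finset.Icc 1 n,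
            (QSelberg.qGamma q (α + ((j - 1 : ℕ) : ℂ) * τ) *
                QSelberg.qGamma q (β + ((j - 1 : ℕ) : ℂ) * τ) *
                QSelberg.qGamma q ((j : ℂ) * τ)) /
              (QSelberg.qGamma q (α + β + ((n + j - 2 : ℕ) : ℂ) * τ) * QSelberg.qGamma q (τ : ℂ)) *
            ((x₁ * x₂) ^ (1 + (j - 1) * τ) / (x₁ - x₂)) *
            QSelberg.qPochC q (x₂ / x₁) (α + ((j - 1 : ℕ) : ℂ) * τ) *
            QSelberg.qPochC q (x₁ / x₂) (β + ((j - 1 : ℕ) : ℂ) * τ)) := by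
  refine ⟨?_, ?_⟩
  · rintro a₁ a₂ b₁ b₂ ha₁ ha₂ h₁₁ h₁₂ h₂₁ h₂₂ t rfl
    have h : QSelberg.Admissible q a₁ a₂ b₁ b₂ := ⟨ha₁, ha₂, h₁₁, h₁₂, h₂₁, h₂₂⟩
    refine ⟨QSelberg.jacksonConverges_integrand hq0 hq1 n τ h, ?_⟩
    rw [QSelberg.iteratedJackson_integrand_eq hq0 hq1 hτ h, QSelberg.prod_Icc_one_eq]
    congr 1
    refine Finset.prod_congr rfl fun j _ => ?_
    have hj := j.isLt
    rw [QSelberg.selbergFactor, show n + ((j : ℕ) + 1) - 2 = n - 1 + j by omega,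
      Nat.add_sub_cancel, show n - ((j : ℕ) + 1) = n - 1 - j by omega]
  · intro x₁ x₂ α β hx₁ hx₂ hx h₁ h₂ h₃ h₄
    have hq := QSelberg.ofReal_q_ne_zero hq0
    have h : QSelberg.Admissible q x₁ x₂ ((q : ℂ) ^ α / x₁) ((q : ℂ) ^ β / x₂) := by
      refine ⟨hx₁, hx₂, fun m => ?_, fun m => ?_, fun m => ?_, fun m => ?_⟩
      · rw [mul_div_cancel₀ _ hx₁]; exact h₁ m
      · rw [mul_div_left_comm]; exact h₄ m
      · rw [mul_div_left_comm]; exact h₃ m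
      · rw [mul_div_cancel₀ _ hx₂]; exact h₂ m
    have heq := fun (z : Fin n → ℂ) (hz : ∀ i, z i ≠ 0) =>
      QSelberg.askeyEvansIntegrand_eq hq0 hτ hx₁ hx₂ α β hz
    refine ⟨((QSelberg.jacksonConverges_integrand hq0 hq1 n τ h).const_mul _).congr hq0 hx₁ hx₂
      fun z hz => (heq z hz).symm, ?_⟩
    rw [QSelberg.iteratedJackson_congr hq0 hx₁ hx₂ heq, QSelberg.iteratedJackson_const_mul,
      mul_left_comm, QSelberg.iteratedJackson_integrand_eq hq0 hq1 hτ h,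
      ← QSelberg.prod_askeyEvansFactor hq0 hq1 hτ α β h hx, QSelberg.prod_Icc_one_eq, ← mul_assoc]
    congr 1
    · rw [zpow_sub₀ hq, mul_pow, ← pow_mul, inv_pow, ← pow_mul]
      norm_cast
      push_cast
      ring
    · refine Finset.prod_congr rfl fun j _ => ?_
      have hj := j.isLt
      rw [QSelberg.askeyEvansFactor, show n + ((j : ℕ) + 1) - 2 = n - 1 + j by omega,
        Nat.add_sub_cancel]
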